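/- Let $S_n$ be the set of permutations of $[n]=\{1,\dots,n\}$. Two permutations $\pi,\sigma\in S_n$ are \emph{disjoint} if $\pi(i)\ne\sigma(i)$ for all $i\in[n]$. For $\mathcal F\subseteq S_n$ let $\mathrm{disj}(\mathcal F)$ be the number of unordered pairs of disjoint permutations in $\mathcal F$, and for $\pi\in S_n$ let $\mathrm{disj}(\pi,\mathcal F)$ be the number of $\sigma\in\mathcal F$ disjoint from $\pi$. For $i,j\in[n]$ the \emph{coset} $\mathcal T_{(i,j)}$ is $\{\pi\in S_n:\pi(i)=j\}$. For $0\le s\le n!$ let $\mathcal T(n,s)$ be the set of the first $s$ permutations in the lexicographic order ($\pi<\sigma$ if for some $k$ we have $\pi(k)<\sigma(k)$ and $\pi(i)=\sigma(i)$ for all $i<k$). Let $d_m$ be the number of derangements of $m$ points and $D_m=d_m+d_{m-1}$. For real numbers, $a=b\pm e$ means $b-e\le a\le b+e$. Given a union $\mathcal G=\bigcup_{x\in V}\mathcal T_x$ of distinct cosets, where $V\subseteq[n]^2$, its \emph{intersection graph} $G$ has vertex set $V$, two distinct vertices being adjacent if the corresponding cosets have non-empty intersection. Let $k_t$ be the number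 of $t$-cliques of $G$, so that $k_1=|V|$ is the number of cosets. Call $\mathcal G$ \emph{canonical} if at least $k_1-1$ of these cosets are pairwise disjoint. \textbf{Proposition.} There is an absolute constant $c>0$ such that whenever $2\le k_1\le c\,n^{1/2}$ and $\mathcal G$ is a union of $k_1$ cosets in $S_n$ with intersection graph $G$, the following hold: (a) $|\mathcal G| = k_1 (n-1)! - k_2 (n-2)! + k_3 (n-3)! \pm k_4 (n-4)!$; (b) $\mathrm{disj}(\pi,\mathcal G) = k_1 D_{n-1} - k_2 D_{n-2} \pm 3 k_1 k_2 (n-3)!$ for every $\pi\in S_n\setminus\mathcal G$; (c) $\mathrm{disj}(\mathcal G) = \binom{k_1}{2}(n-1)!\,D_{n-1} - (k_1-1)k_2 (n-2)!\,D_{n-1} \pm 2 k_1^2 k_2 (n-1)!\,(n-3)!$; (d) $\mathrm{disj}(\mathcal G)\ge \mathrm{disj}(\mathcal T(n,|\mathcal G|))$, with equality if and only if $\mathcal G$ is canonical. -/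

import Mathlib

open scoped Nat

namespace PermSupersat

/-- Two permutations are disjoint if they agree at no point (this is not `Equiv.Perm.Disjoint`,
which is about supports). -/
def DisjointPerms {n : ℕ} (π σ : Equiv.Perm (Fin n)) : Prop := ∀ i, π i ≠ σ i

instance {n : ℕ} (π σ : Equiv.Perm (Fin n)) : Decidable (DisjointPerms π σ) :=
  inferInstanceAs (Decidable (∀ i, π i ≠ σ i))

/-- `disj(π, F)`: the number of members of `F` that are disjoint from `π`. -/
def disjFrom {n : ℕ} (π : Equiv.Perm (Fin n)) (F : Finset (Equiv.Perm (Fin n))) : ℕ :=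
  (F.filter fun σ => DisjointPerms π σ).card

/-- `disj(F)`: the number of unordered pairs of disjoint permutations in `F`, that is,
of two-element subsets of `F` whose two members are disjoint. -/
def disj {n : ℕ} (F : Finset (Equiv.Perm (Fin n))) : ℕ :=
  ((F.powersetCard 2).filter fun P => ∀ π ∈ P, ∀ σ ∈ P, π ≠ σ → DisjointPerms π σ).card

/-- The coset `T_{(i,j)}` of all permutations that map `i` to `j`, for `x = (i, j)`. -/
def coset {n : ℕ} (x : Fin n × Fin n) : Finset (Equiv.Perm (Fin n)) :=
  Finset.univ.filter fun π => π x.1 = x.2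

/-- The union of the cosets `T_x`, `x ∈ V`. -/
def cosetUnion {n : ℕ} (V : Finset (Fin n × Fin n)) : Finset (Equiv.Perm (Fin n)) :=
  V.biUnion coset

/-- The intersection graph of the cosets `T_x`, `x ∈ V`: its vertices are the members of `V`, and
two distinct ones are adjacent if their cosets have non-empty intersection. -/
def intersectionGraph {n : ℕ} (V : Finset (Fin n × Fin n)) : SimpleGraph V where
  Adj x y := x ≠ y ∧ (coset x.1 ∩ coset y.1).Nonempty
  symm := ⟨fun _ _ h => ⟨h.1.symm, by rw [Finset.inter_comm]; exact h.2⟩⟩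
  loopless := ⟨fun _ h => h.1 rfl⟩

/-- `k_t(V)`: the number of `t`-cliques of the intersection graph of the cosets `T_x`, `x ∈ V`. -/
noncomputable def cliqueCount {n : ℕ} (V : Finset (Fin n × Fin n)) (t : ℕ) : ℕ :=
  ((intersectionGraph V).cliqueSet t).ncard

/-- At least `|V| - 1` of the cosets `T_x`, `x ∈ V`, are pairwise disjoint. -/
def IsCanonical {n : ℕ} (V : Finset (Fin n × Fin n)) : Prop :=
  ∃ U ⊆ V, V.card ≤ U.card + 1 ∧ (U : Set (Fin n × Fin n)).PairwiseDisjoint coset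

/-- The strict lexicographic order on permutations. -/
def LexLT {n : ℕ} (π σ : Equiv.Perm (Fin n)) : Prop :=
  ∃ k, π k < σ k ∧ ∀ i < k, π i = σ i

instance {n : ℕ} (π σ : Equiv.Perm (Fin n)) : Decidable (LexLT π σ) :=
  inferInstanceAs (Decidable (∃ k, π k < σ k ∧ ∀ i < k, π i = σ i))

/-- `T(n, s)`: the first `s` permutations in the lexicographic order, that is, those with
fewer than `s` predecessors. -/
def lexInitial (n s : ℕ) : Finset (Equiv.Perm (Fin n)) :=
  Finset.univ.filter fun π => (Finset.univ.filter fun σ => LexLT σ π).card < s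

/-- `D_m = d_m + d_{m-1}`, where `d_m` is the number of derangements of `m` points; it is used
for `m ≥ 1` only. -/
def numD (m : ℕ) : ℕ := numDerangements m + numDerangements (m - 1)

end PermSupersat

open PermSupersat

namespace PermSupersat

open Finset

/-! ### Derangement numbers -/

/-! Everything rests on the multiplicity `mult V σ`, the number of chosen cosets containing σ. Any t
pairwise compatible cells lie in exactly (n-t)! permutations (`card_meet`), so summing
binomial(mult, t) over all σ counts t-cliques, and Bonferroni's inequalities give the size of the
union. Restricting the sums to the σ disjoint from an outside π gives the second estimate: each
coset contributes exactly D_{n-1} (`disjFrom_coset`) and each intersecting pair contributes D_{n-2}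
up to (n-3)!, by counting derangements with two prescribed values (`derCount_bounds`).

For pairs inside the union, write k for the number of cosets. A lexicographic segment of size
between (k-1)(n-1)! and k(n-1)! is k-1 whole cosets of the first row and a part of the next, so its
number of disjoint pairs is linear in its size (`disj_lexInitial`). For small k the size of the
union falls in this range, and `excess` is then the difference that has to be shown non-negative.

Adding a coset T_x raises the excess by the sum over σ of max(mult - 1, 0) times D_{n-1} minus the
number of new permutations disjoint from σ (`excess_insert`). No term is negative, since σ is
disjoint from at most D_{n-1} members of T_x. For a canonical union all multiplicities are at most 1
until the last coset arrives, so the excess is 0. Otherwise the intersection graph has a triangle or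
two disjoint edges, and adding one of their vertices last makes some term positive. Bounding the
increments from above (`excess_le`) and inserting the size estimate gives the asymptotic count of
disjoint pairs. -/

theorem numD_succ (m : ℕ) : numD (m + 1) = numDerangements (m + 1) + numDerangements m := rfl

theorem numDerangements_eq_mul_numD (m : ℕ) :
    numDerangements (m + 2) = (m + 1) * numD (m + 1) := by
  rw [numDerangements_add_two, numD_succ, add_comm (numDerangements m)]

theorem numD_pos (m : ℕ) : 0 < numD (m + 1) := by
  induction m with
  | zero => decide
  | succ m ih =>
    rw [numD_succ, numDerangements_eq_mul_numD]
    positivity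

theorem numDerangements_pos (m : ℕ) : 0 < numDerangements (m + 2) := by
  rw [numDerangements_eq_mul_numD]
  exact Nat.mul_pos m.succ_pos (numD_pos m)

/-! ### Permutations extending a partial injection -/

/-- Two cells are compatible if they lie in different rows and different columns. -/
def Compat {n : ℕ} (x y : Fin n × Fin n) : Prop := x.1 ≠ y.1 ∧ x.2 ≠ y.2

instance {n : ℕ} (x y : Fin n × Fin n) : Decidable (Compat x y) :=
  inferInstanceAs (Decidable (_ ∧ _))

theorem Compat.symm {n : ℕ} {x y : Fin n × Fin n} (h : Compat x y) : Compat y x :=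
  ⟨h.1.symm, h.2.symm⟩

theorem Compat.ne {n : ℕ} {x y : Fin n × Fin n} (h : Compat x y) : x ≠ y :=
  fun e => h.1 (e ▸ rfl)

theorem mem_coset {n : ℕ} {x : Fin n × Fin n} {π : Equiv.Perm (Fin n)} :
    π ∈ coset x ↔ π x.1 = x.2 := by
  simp [coset]

theorem compat_of_mem_coset {n : ℕ} {x y : Fin n × Fin n} (hxy : x ≠ y)
    {π : Equiv.Perm (Fin n)} (hx : π ∈ coset x) (hy : π ∈ coset y) : Compat x y := by
  rw [mem_coset] at hx hy
  refine ⟨fun h => hxy (Prod.ext h ?_), fun h => hxy (Prod.ext ?_ h)⟩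
  · rw [← hx, ← hy, h]
  · exact π.injective (by rw [hx, hy, h])

/-- The permutations that lie in all cosets `T_x`, `x ∈ S`. -/
def meet {n : ℕ} (S : Finset (Fin n × Fin n)) : Finset (Equiv.Perm (Fin n)) :=
  univ.filter fun σ => ∀ x ∈ S, σ x.1 = x.2

theorem mem_meet {n : ℕ} {S : Finset (Fin n × Fin n)} {π : Equiv.Perm (Fin n)} :
    π ∈ meet S ↔ ∀ x ∈ S, π ∈ coset x := by
  simp [meet, mem_coset]

/-- Pairwise compatible cells form the graph of a partial injection, which extends to a permutation
of the finite set. -/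
theorem exists_mem_meet {n : ℕ} {S : Finset (Fin n × Fin n)}
    (hS : (S : Set (Fin n × Fin n)).Pairwise Compat) : ∃ τ, τ ∈ meet S := by
  have hex : ∀ i ∈ S.image Prod.fst, ∃ j, (i, j) ∈ S := by
    intro i hi
    obtain ⟨x, hx, rfl⟩ := mem_image.1 hi
    exact ⟨x.2, hx⟩
  choose! f hf using hex
  have hinj : Set.InjOn f (S.image Prod.fst : Finset (Fin n)) := by
    intro a ha b hb hab
    by_contra hne
    exact (hS (hf a ha) (hf b hb) (fun e => hne (congrArg Prod.fst e))).2 hab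
  obtain ⟨g, hg⟩ := Finset.exists_equiv_extend_of_card_eq (t := univ) (by simp)
    (subset_univ ((S.image Prod.fst).image f)) hinj
  refine ⟨g.trans (Equiv.subtypeUnivEquiv (fun x => mem_univ x)), mem_meet.2 fun x hx => ?_⟩
  rw [mem_coset]
  have hx' : x.1 ∈ S.image Prod.fst := mem_image_of_mem _ hx
  have h1 : ((g x.1 : _) : Fin n) = f x.1 := hg _ hx'
  refine h1.trans ?_
  by_contra hne
  exact (hS (hf _ hx') hx (fun e => hne (congrArg Prod.snd e))).1 rfl

theorem card_meet {n : ℕ} {S : Finset (Fin n × Fin n)}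
    (hS : (S : Set (Fin n × Fin n)).Pairwise Compat) : (meet S).card = (n - S.card)! := by
  obtain ⟨τ, hτ⟩ := exists_mem_meet hS
  rw [mem_meet] at hτ
  have hfst : (S.image Prod.fst).card = S.card := by
    refine card_image_of_injOn fun x hx y hy hxy => ?_
    by_contra hne
    exact (hS hx hy hne).1 hxy
  -- Left translation by τ⁻¹ turns the prescribed values into fixed points. The double negation
  -- matches `Equiv.Perm.subtypeEquivSubtypePerm`.
  have h1 : (meet S).card = Fintype.card
      {ρ : Equiv.Perm (Fin n) // ∀ a, ¬ (a ∉ S.image Prod.fst) → ρ a = a} := by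
    rw [Fintype.card_subtype]
    refine card_bij' (fun σ _ => τ⁻¹ * σ) (fun ρ _ => τ * ρ) ?_ ?_ ?_ ?_
    · intro σ hσ
      simp only [mem_filter, mem_univ, true_and, not_not, mem_image, forall_exists_index, and_imp]
      rintro a x hx rfl
      rw [Equiv.Perm.mul_apply, mem_coset.1 (mem_meet.1 hσ x hx), Equiv.Perm.inv_eq_iff_eq,
        mem_coset.1 (hτ x hx)]
    · intro ρ hρ
      simp only [mem_filter, mem_univ, true_and, not_not] at hρ
      refine mem_meet.2 fun x hx => mem_coset.2 ?_
      rw [Equiv.Perm.mul_apply, hρ _ (mem_image_of_mem _ hx), mem_coset.1 (hτ x hx)]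
    · intro σ _; simp
    · intro ρ _; simp
  rw [h1, ← Fintype.card_congr (Equiv.Perm.subtypeEquivSubtypePerm _), Fintype.card_perm,
    Fintype.card_subtype]
  congr 1
  rw [filter_not, filter_mem_eq_inter, univ_inter, card_sdiff_of_subset (subset_univ _), hfst, card_univ,
    Fintype.card_fin]

/-! ### Derangements with one or two prescribed values -/

/-- The number of derangements that map `i` to `j` and `k` to `l`. -/
def derCount {n : ℕ} (i j k l : Fin n) : ℕ :=
  (univ.filter fun σ : Equiv.Perm (Fin n) => (∀ a, σ a ≠ a) ∧ σ i = j ∧ σ k = l).card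

/-- Conjugation preserves derangements, so only the coincidences among the four points matter. -/
theorem derCount_conj {n : ℕ} (e : Equiv.Perm (Fin n)) (i j k l : Fin n) :
    derCount (e i) (e j) (e k) (e l) = derCount i j k l := by
  refine card_bij' (fun σ _ => e⁻¹ * σ * e) (fun ρ _ => e * ρ * e⁻¹) ?_ ?_ ?_ ?_
  · intro σ hσ
    simp only [mem_filter, mem_univ, true_and] at hσ ⊢
    refine ⟨fun a h => hσ.1 (e a) ?_, ?_, ?_⟩
    · rwa [Equiv.Perm.mul_apply, Equiv.Perm.mul_apply, Equiv.Perm.inv_eq_iff_eq] at h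
    · simp [hσ.2.1]
    · simp [hσ.2.2]
  · intro σ hσ
    simp only [mem_filter, mem_univ, true_and] at hσ ⊢
    refine ⟨fun a h => hσ.1 (e⁻¹ a) ?_, ?_, ?_⟩
    · rw [Equiv.Perm.mul_apply, Equiv.Perm.mul_apply] at h
      rw [Equiv.Perm.eq_inv_iff_eq, h]
    · simp [hσ.2.1]
    · simp [hσ.2.2]
  · intro σ _; simp [mul_assoc]
  · intro σ _; simp [mul_assoc]

theorem derCount_comm {n : ℕ} (i j k l : Fin n) : derCount i j k l = derCount k l i j := by
  simp only [derCount, and_comm (a := (_ : Equiv.Perm (Fin n)) i = j)]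

theorem sum_derCount {n : ℕ} (i j k : Fin n) :
    ∑ l, derCount i j k l = derCount i j i j := by
  have h := card_eq_sum_card_fiberwise (t := univ) (f := fun σ : Equiv.Perm (Fin n) => σ k)
    (s := univ.filter fun σ : Equiv.Perm (Fin n) => (∀ a, σ a ≠ a) ∧ σ i = j ∧ σ i = j)
    (fun _ _ => mem_coe.2 (mem_univ _))
  rw [derCount, h]
  refine sum_congr rfl fun l _ => ?_
  rw [derCount, filter_filter]
  congr 1
  ext σ
  simp only [mem_filter, mem_univ, true_and]
  tauto

theorem sum_derCount_diag {n : ℕ} (i : Fin n) :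
    ∑ j, derCount i j i j = numDerangements n := by
  have h := card_eq_sum_card_fiberwise (t := univ) (f := fun σ : Equiv.Perm (Fin n) => σ i)
    (s := univ.filter fun σ : Equiv.Perm (Fin n) => ∀ a, σ a ≠ a)
    (fun _ _ => mem_coe.2 (mem_univ _))
  have h2 : (univ.filter fun σ : Equiv.Perm (Fin n) => ∀ a, σ a ≠ a).card = numDerangements n := by
    rw [← card_derangements_fin_eq_numDerangements, ← Fintype.card_subtype]
    exact Fintype.card_congr (Equiv.refl _)
  rw [← h2, h]
  refine sum_congr rfl fun l _ => ?_
  rw [derCount, filter_filter]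
  congr 1
  ext σ
  simp

theorem derCount_eq_zero {n : ℕ} {i j k l : Fin n}
    (h : i = j ∨ k = l ∨ (i = k ∧ j ≠ l) ∨ (i ≠ k ∧ j = l)) : derCount i j k l = 0 := by
  rw [derCount, card_eq_zero, filter_eq_empty_iff]
  rintro σ - ⟨hd, h1, h2⟩
  rcases h with h | h | ⟨h, h'⟩ | ⟨h, h'⟩
  · exact hd i (h1.trans h.symm)
  · exact hd k (h2.trans h.symm)
  · exact h' (by rw [← h1, ← h2, h])
  · exact h (σ.injective (by rw [h1, h2, h']))

theorem derCount_congr_right {n : ℕ} {i j k l l' : Fin n} (hi : i ≠ l) (hi' : i ≠ l')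
    (hj : j ≠ l) (hj' : j ≠ l') (hk : k ≠ l) (hk' : k ≠ l') :
    derCount i j k l' = derCount i j k l := by
  have := derCount_conj (Equiv.swap l l') i j k l
  rwa [Equiv.swap_apply_of_ne_of_ne hi hi', Equiv.swap_apply_of_ne_of_ne hj hj',
    Equiv.swap_apply_of_ne_of_ne hk hk', Equiv.swap_apply_left] at this

theorem derCount_one {n : ℕ} {i j : Fin n} (hij : i ≠ j) :
    derCount i j i j = numD (n - 1) := by
  obtain ⟨m, rfl⟩ : ∃ m, n = m + 2 := by
    refine ⟨n - 2, ?_⟩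
    have := Fin.val_ne_of_ne hij
    omega
  have h := sum_derCount_diag i
  rw [← add_sum_erase _ _ (mem_univ i), derCount_eq_zero (Or.inl rfl), zero_add,
    sum_congr rfl (g := fun _ => derCount i j i j), sum_const, card_erase_of_mem (mem_univ _),
    card_univ, Fintype.card_fin, smul_eq_mul, numDerangements_eq_mul_numD] at h
  · exact Nat.eq_of_mul_eq_mul_left m.succ_pos h
  · intro j' hj'
    have hj' : i ≠ j' := (ne_of_mem_erase hj').symm
    by_cases hjj : j = j'
    · rw [hjj]
    have := derCount_conj (Equiv.swap j j') i j i j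
    rwa [Equiv.swap_apply_of_ne_of_ne hij hj', Equiv.swap_apply_left] at this

/-- Composing with the transposition makes i and j the only fixed points, leaving a derangement of
the other n-2 points. -/
theorem derCount_swap {n : ℕ} {i j : Fin n} (hij : i ≠ j) :
    derCount i j j i = numDerangements (n - 2) := by
  have hc : Fintype.card {a : Fin n // a ∉ ({i, j} : Finset (Fin n))} = n - 2 := by
    rw [Fintype.card_subtype, filter_not, filter_mem_eq_inter, univ_inter,
      card_sdiff_of_subset (subset_univ _), card_pair hij, card_univ, Fintype.card_fin]
  rw [← hc, ← card_derangements_eq_numDerangements,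
    Fintype.card_congr (derangements.subtypeEquiv _), Fintype.card_subtype]
  have hsw : ∀ a, a ≠ i → a ≠ j → Equiv.swap i j a = a := fun a =>
    Equiv.swap_apply_of_ne_of_ne
  refine card_bij' (fun σ _ => σ * Equiv.swap i j) (fun σ _ => σ * Equiv.swap i j) ?_ ?_ ?_ ?_
  · intro σ hσ
    simp only [mem_filter, mem_univ, true_and, not_not, mem_insert, mem_singleton,
      Function.mem_fixedPoints, Function.IsFixedPt, Equiv.Perm.mul_apply] at hσ ⊢
    intro a
    constructor
    · rintro (rfl | rfl)
      · rw [Equiv.swap_apply_left, hσ.2.2]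
      · rw [Equiv.swap_apply_right, hσ.2.1]
    · intro h
      by_contra hne
      rw [not_or] at hne
      rw [hsw a hne.1 hne.2] at h
      exact hσ.1 a h
  · intro σ hσ
    simp only [mem_filter, mem_univ, true_and, not_not, mem_insert, mem_singleton,
      Function.mem_fixedPoints, Function.IsFixedPt, Equiv.Perm.mul_apply] at hσ ⊢
    have hi := (hσ i).1 (Or.inl rfl)
    have hj := (hσ j).1 (Or.inr rfl)
    refine ⟨fun a h => ?_, ?_, ?_⟩
    · by_cases hai : a = i
      · rw [hai, Equiv.swap_apply_left, hj] at h
        exact hij h.symm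
      by_cases haj : a = j
      · rw [haj, Equiv.swap_apply_right, hi] at h
        exact hij h
      rw [hsw a hai haj] at h
      rcases (hσ a).2 h with h | h
      · exact hai h
      · exact haj h
    · rw [Equiv.swap_apply_left, hj]
    · rw [Equiv.swap_apply_right, hi]
  · intro σ _; simp [mul_assoc]
  · intro σ _; simp [mul_assoc]

/-- Among the D_{n-1} derangements with i ↦ j, those with j ↦ i number d_{n-2}; by symmetry the
remaining d_{n-1} = (n-2) D_{n-2} split equally over the n-2 other images of j. -/
theorem derCount_path {n : ℕ} (hn : 3 ≤ n) {i j k : Fin n} (hij : i ≠ j) (hik : i ≠ k)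
    (hjk : j ≠ k) : derCount i j j k = numD (n - 2) := by
  obtain ⟨m, rfl⟩ := Nat.exists_eq_add_of_le' hn
  have h := sum_derCount i j j
  have hji : j ∈ univ.erase i := mem_erase.2 ⟨hij.symm, mem_univ _⟩
  rw [derCount_one hij, ← add_sum_erase _ _ (mem_univ i), derCount_swap hij,
    ← add_sum_erase _ _ hji, derCount_eq_zero (Or.inr (Or.inl rfl)), zero_add,
    sum_congr rfl (g := fun _ => derCount i j j k), sum_const, card_erase_of_mem hji,
    card_erase_of_mem (mem_univ _), card_univ, Fintype.card_fin, smul_eq_mul] at h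
  · have h2 : numDerangements (m + 3 - 2) + (m + 1) * derCount i j j k =
        numDerangements (m + 2) + numDerangements (m + 1) := h
    rw [numDerangements_eq_mul_numD] at h2
    rw [show m + 3 - 2 = m + 1 by omega] at h2 ⊢
    exact Nat.eq_of_mul_eq_mul_left m.succ_pos (show (m + 1) * _ = (m + 1) * _ by linarith)
  · intro l hl
    simp only [mem_erase, mem_univ, and_true] at hl
    exact derCount_congr_right hik hl.2.symm hjk hl.1.symm hjk hl.1.symm

/-- The same splitting by the image l of k: l = i is a path, l = j and l = k are impossible, and the
other n-3 images are equally frequent. -/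
theorem derCount_four {n : ℕ} (hn : 4 ≤ n) {i j k l : Fin n} (hij : i ≠ j) (hik : i ≠ k)
    (hil : i ≠ l) (hjk : j ≠ k) (hjl : j ≠ l) (hkl : k ≠ l) :
    derCount i j k l = numD (n - 2) + numD (n - 3) := by
  obtain ⟨m, rfl⟩ := Nat.exists_eq_add_of_le' hn
  have h := sum_derCount i j k
  have hji : j ∈ univ.erase i := mem_erase.2 ⟨hij.symm, mem_univ _⟩
  have hk : k ∈ (univ.erase i).erase j := mem_erase.2 ⟨hjk.symm, mem_erase.2 ⟨hik.symm, mem_univ _⟩⟩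
  rw [derCount_one hij, ← add_sum_erase _ _ (mem_univ i), derCount_comm i j k i,
    derCount_path (by omega) hik.symm hjk.symm hij,
    ← add_sum_erase _ _ hji, derCount_eq_zero (Or.inr (Or.inr (Or.inr ⟨hik, rfl⟩))), zero_add,
    ← add_sum_erase _ _ hk, derCount_eq_zero (Or.inr (Or.inl rfl)), zero_add,
    sum_congr rfl (g := fun _ => derCount i j k l), sum_const, card_erase_of_mem hk,
    card_erase_of_mem hji,
    card_erase_of_mem (mem_univ _), card_univ, Fintype.card_fin, smul_eq_mul] at h
  · have h2 : numD (m + 2) + (m + 1) * derCount i j k l =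
        numDerangements (m + 3) + numDerangements (m + 2) := h
    rw [numDerangements_eq_mul_numD, numDerangements_eq_mul_numD] at h2
    change _ = numD (m + 2) + numD (m + 1)
    exact Nat.eq_of_mul_eq_mul_left m.succ_pos (by linarith)
  · intro l' hl
    simp only [mem_erase, mem_univ, and_true] at hl
    exact derCount_congr_right hil hl.2.2.symm hjl hl.2.1.symm hkl hl.1.symm

theorem derCount_bounds {n : ℕ} (hn : 4 ≤ n) {i j k l : Fin n} (hij : i ≠ j) (hkl : k ≠ l)
    (hik : i ≠ k) (hjl : j ≠ l) :
    numDerangements (n - 2) ≤ derCount i j k l ∧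
      derCount i j k l ≤ numD (n - 2) + numD (n - 3) := by
  by_cases hjk : j = k
  · subst hjk
    by_cases hil : i = l
    · subst hil
      rw [derCount_swap hij, numD]
      omega
    · rw [derCount_path (by omega) hij hil hkl, numD]
      omega
  · by_cases hil : i = l
    · subst hil
      rw [derCount_comm, derCount_path (by omega) hik.symm (Ne.symm hjk) hij, numD]
      omega
    · rw [derCount_four hn hij hik hil hjk hjl hkl, numD]
      omega

/-! ### Permutations disjoint from a given one in a coset -/

theorem card_filter_disjoint {n : ℕ} (π : Equiv.Perm (Fin n)) (i j k l : Fin n) :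
    (univ.filter fun σ => DisjointPerms π σ ∧ σ i = j ∧ σ k = l).card =
      derCount i (π⁻¹ j) k (π⁻¹ l) := by
  refine card_bij' (fun σ _ => π⁻¹ * σ) (fun ρ _ => π * ρ) ?_ ?_ ?_ ?_
  · intro σ hσ
    simp only [mem_filter, mem_univ, true_and] at hσ ⊢
    refine ⟨fun a (h : _ = _) => hσ.1 a ?_, ?_, ?_⟩
    · rw [Equiv.Perm.mul_apply, Equiv.Perm.inv_eq_iff_eq] at h
      exact h.symm
    · simp [hσ.2.1]
    · simp [hσ.2.2]
  · intro σ hσ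
    simp only [mem_filter, mem_univ, true_and] at hσ ⊢
    refine ⟨fun a (h : _ = _) => hσ.1 a ?_, ?_, ?_⟩
    · rw [Equiv.Perm.mul_apply] at h
      exact (π.injective h).symm
    · simp [hσ.2.1]
    · simp [hσ.2.2]
  · intro σ _; simp
  · intro σ _; simp

theorem disjFrom_coset {n : ℕ} {x : Fin n × Fin n} {π : Equiv.Perm (Fin n)} (h : π ∉ coset x) :
    disjFrom π (coset x) = numD (n - 1) := by
  rw [mem_coset] at h
  have hne : x.1 ≠ π⁻¹ x.2 := fun e => h (by rw [e]; simp)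
  rw [← derCount_one hne, ← card_filter_disjoint, disjFrom, coset, filter_filter]
  congr 1
  ext σ
  simp only [mem_filter, mem_univ, true_and]
  tauto

theorem disjFrom_coset_eq_zero {n : ℕ} {x : Fin n × Fin n} {π : Equiv.Perm (Fin n)}
    (h : π ∈ coset x) : disjFrom π (coset x) = 0 := by
  rw [disjFrom, card_eq_zero, filter_eq_empty_iff]
  intro σ hσ hd
  rw [mem_coset] at h hσ
  exact hd x.1 (h.trans hσ.symm)

theorem disjFrom_meet_pair {n : ℕ} (hn : 4 ≤ n) {x y : Fin n × Fin n} {π : Equiv.Perm (Fin n)}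
    (hx : π ∉ coset x) (hy : π ∉ coset y) (hxy : Compat x y) :
    numDerangements (n - 2) ≤ disjFrom π (meet {x, y}) ∧
      disjFrom π (meet {x, y}) ≤ numD (n - 2) + numD (n - 3) := by
  rw [mem_coset] at hx hy
  have hx' : x.1 ≠ π⁻¹ x.2 := fun e => hx (by rw [e]; simp)
  have hy' : y.1 ≠ π⁻¹ y.2 := fun e => hy (by rw [e]; simp)
  have h := derCount_bounds hn hx' hy' hxy.1 (fun e => hxy.2 (π⁻¹.injective e))
  rw [← card_filter_disjoint] at h
  have e : disjFrom π (meet {x, y}) =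
      (univ.filter fun σ => DisjointPerms π σ ∧ σ x.1 = x.2 ∧ σ y.1 = y.2).card := by
    rw [disjFrom, meet, filter_filter]
    congr 1
    ext σ
    simp only [mem_filter, mem_univ, true_and, mem_insert, mem_singleton, forall_eq_or_imp,
      forall_eq]
    tauto
  rwa [e]

theorem meet_singleton {n : ℕ} (x : Fin n × Fin n) : meet {x} = coset x := by
  ext σ; simp [mem_meet]

theorem card_coset {n : ℕ} (x : Fin n × Fin n) : (coset x).card = (n - 1)! := by
  rw [← meet_singleton, card_meet (by simp), card_singleton]

/-- D_{m+1} counts a subset of a coset in the symmetric group on m+2 points. -/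
theorem numD_le_factorial (m : ℕ) : numD (m + 1) ≤ (m + 1)! := by
  have h : (1 : Equiv.Perm (Fin (m + 2))) ∉ coset ((0 : Fin (m + 2)), (1 : Fin (m + 2))) := by
    rw [mem_coset]; simp
  have e := disjFrom_coset h
  have e2 := card_coset ((0 : Fin (m + 2)), (1 : Fin (m + 2)))
  simp only [show m + 2 - 1 = m + 1 by omega] at e e2
  rw [← e, ← e2]
  exact card_filter_le _ _

/-! ### Multiplicities and cliques -/

/-- The number of the cosets `T_x`, `x ∈ V`, that contain `σ`. -/
def mult {n : ℕ} (V : Finset (Fin n × Fin n)) (σ : Equiv.Perm (Fin n)) : ℕ :=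
  (V.filter fun x => σ ∈ coset x).card

open Classical in
/-- The sets of `t` pairwise compatible cells in `V`. -/
noncomputable def cliques {n : ℕ} (V : Finset (Fin n × Fin n)) (t : ℕ) :
    Finset (Finset (Fin n × Fin n)) :=
  (V.powersetCard t).filter fun S => (S : Set (Fin n × Fin n)).Pairwise Compat

theorem mem_cliques {n t : ℕ} {V S : Finset (Fin n × Fin n)} :
    S ∈ cliques V t ↔ S ⊆ V ∧ S.card = t ∧ (S : Set (Fin n × Fin n)).Pairwise Compat := by
  simp [cliques, mem_powersetCard, and_assoc]

theorem mem_cosetUnion {n : ℕ} {V : Finset (Fin n × Fin n)} {σ : Equiv.Perm (Fin n)} :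
    σ ∈ cosetUnion V ↔ ∃ x ∈ V, σ ∈ coset x := by
  simp [cosetUnion]

theorem mult_pos_iff {n : ℕ} {V : Finset (Fin n × Fin n)} {σ : Equiv.Perm (Fin n)} :
    0 < mult V σ ↔ σ ∈ cosetUnion V := by
  rw [mult, card_pos, filter_nonempty_iff, mem_cosetUnion]

theorem pair_pairwise_compat {n : ℕ} {x y : Fin n × Fin n} (h : Compat x y) :
    (({x, y} : Finset (Fin n × Fin n)) : Set (Fin n × Fin n)).Pairwise Compat := by
  rw [coe_pair, Set.pairwise_pair]
  exact fun _ => ⟨h, h.symm⟩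

theorem compat_iff_inter_nonempty {n : ℕ} {x y : Fin n × Fin n} (hxy : x ≠ y) :
    (coset x ∩ coset y).Nonempty ↔ Compat x y := by
  constructor
  · rintro ⟨σ, hσ⟩
    rw [mem_inter] at hσ
    exact compat_of_mem_coset hxy hσ.1 hσ.2
  · intro h
    obtain ⟨τ, hτ⟩ := exists_mem_meet (pair_pairwise_compat h)
    rw [mem_meet] at hτ
    exact ⟨τ, mem_inter.2 ⟨hτ x (by simp), hτ y (by simp)⟩⟩

/-- Distinct cells have intersecting cosets exactly when they are compatible, so graph cliques can
be handled as finsets of cells. -/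
theorem cliqueCount_eq {n : ℕ} (V : Finset (Fin n × Fin n)) (t : ℕ) :
    cliqueCount V t = (cliques V t).card := by
  have hinj : Function.Injective
      (fun S : Finset V => S.map (Function.Embedding.subtype (· ∈ V))) :=
    Finset.map_injective _
  rw [cliqueCount, ← Set.ncard_image_of_injective _ hinj, ← Set.ncard_coe_finset]
  congr 1
  ext S
  rw [mem_coe, mem_cliques, Set.mem_image]
  constructor
  · rintro ⟨T, hT, rfl⟩
    rw [SimpleGraph.mem_cliqueSet_iff, SimpleGraph.isNClique_iff] at hT
    refine ⟨map_subtype_subset T, by rw [card_map, hT.2], ?_⟩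
    intro x hx y hy hxy
    simp only [coe_map, Set.mem_image, mem_coe, Function.Embedding.subtype_apply] at hx hy
    obtain ⟨a, ha, rfl⟩ := hx
    obtain ⟨b, hb, rfl⟩ := hy
    have := hT.1 ha hb (fun e => hxy (congrArg _ e))
    exact (compat_iff_inter_nonempty hxy).1 this.2
  · rintro ⟨hS, hc, hp⟩
    refine ⟨S.subtype (· ∈ V), ?_, subtype_map_of_mem hS⟩
    rw [SimpleGraph.mem_cliqueSet_iff, SimpleGraph.isNClique_iff]
    constructor
    · intro a ha b hb hab
      rw [mem_coe, mem_subtype] at ha hb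
      have hab' : (a : Fin n × Fin n) ≠ b := fun e => hab (Subtype.ext e)
      exact ⟨hab, (compat_iff_inter_nonempty hab').2 (hp ha hb hab')⟩
    · rw [card_subtype, filter_true_of_mem hS, hc]

theorem card_cliques_two_le {n : ℕ} (V : Finset (Fin n × Fin n)) :
    (cliques V 2).card ≤ V.card.choose 2 :=
  (card_filter_le _ _).trans (card_powersetCard _ _).le

theorem exists_eq_pair_of_mem_cliques {n : ℕ} {V S : Finset (Fin n × Fin n)}
    (h : S ∈ cliques V 2) : ∃ x ∈ V, ∃ y ∈ V, Compat x y ∧ S = {x, y} := by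
  obtain ⟨hS, hc, hp⟩ := mem_cliques.1 h
  obtain ⟨x, y, hxy, rfl⟩ := card_eq_two.1 hc
  exact ⟨x, hS (by simp), y, hS (by simp), hp (by simp) (by simp) hxy, rfl⟩

theorem card_cliques_three_le {n : ℕ} (V : Finset (Fin n × Fin n)) :
    (cliques V 3).card ≤ V.card * (cliques V 2).card := by
  rw [← card_product]
  refine (card_le_card (t := (V ×ˢ cliques V 2).image fun p => insert p.1 p.2) ?_).trans
    card_image_le
  intro S hS
  obtain ⟨hS, hc, hp⟩ := mem_cliques.1 hS
  have hne : S.Nonempty := card_pos.1 (by omega)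
  obtain ⟨x, hx⟩ := hne
  refine mem_image.2 ⟨(x, S.erase x), mem_product.2 ⟨hS hx, mem_cliques.2 ⟨?_, ?_, ?_⟩⟩,
    insert_erase hx⟩
  · exact (erase_subset _ _).trans hS
  · rw [card_erase_of_mem hx, hc]
  · exact hp.mono (by exact_mod_cast erase_subset x S)

/-- Double counting: any set of cells whose cosets share σ is automatically a clique. -/
theorem sum_choose_mult {n : ℕ} (V : Finset (Fin n × Fin n)) (A : Finset (Equiv.Perm (Fin n)))
    (t : ℕ) :
    ∑ σ ∈ A, (mult V σ).choose t = ∑ S ∈ cliques V t, (A.filter (· ∈ meet S)).card := by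
  classical
  have h1 : ∀ σ ∈ A, (mult V σ).choose t =
      ((cliques V t).filter fun S => σ ∈ meet S).card := by
    intro σ _
    rw [mult, ← card_powersetCard]
    congr 1
    ext S
    simp only [mem_powersetCard, mem_filter, mem_cliques, mem_meet, subset_iff]
    constructor
    · rintro ⟨h, hc⟩
      exact ⟨⟨fun x hx => (h hx).1, hc, fun x hx y hy hxy =>
        compat_of_mem_coset hxy (h hx).2 (h hy).2⟩, fun x hx => (h hx).2⟩
    · rintro ⟨⟨h, hc, -⟩, h'⟩
      exact ⟨fun x hx => ⟨h hx, h' x hx⟩, hc⟩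
  rw [sum_congr rfl h1]
  exact sum_card_bipartiteAbove_eq_sum_card_bipartiteBelow _

/-! ### Bonferroni inequalities -/

/-- Pointwise Bonferroni for a positive multiplicity p+1: by Pascal's rule the alternating sum of
binomials truncated at t collapses to ± binomial(p, t). The next two lemmas have the same reason. -/
theorem le_one_add_choose_two (p : ℕ) : p + 1 ≤ 1 + (p + 1).choose 2 := by
  rw [Nat.choose_succ_succ' p 1, Nat.choose_one_right]; omega

theorem one_add_choose_two_le (p : ℕ) : 1 + (p + 1).choose 2 ≤ p + 1 + (p + 1).choose 3 := by
  simp only [Nat.choose_succ_succ', Nat.choose_one_right, Nat.reduceAdd]; omega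

theorem add_choose_three_le (p : ℕ) :
    p + 1 + (p + 1).choose 3 ≤ 1 + (p + 1).choose 2 + (p + 1).choose 4 := by
  simp only [Nat.choose_succ_succ', Nat.choose_one_right, Nat.reduceAdd]; omega

section Bonferroni

variable {n : ℕ} (V : Finset (Fin n × Fin n)) (A : Finset (Equiv.Perm (Fin n)))

theorem card_filter_cosetUnion : (A.filter (· ∈ cosetUnion V)).card =
    ∑ σ ∈ A, if 0 < mult V σ then 1 else 0 := by
  simp only [mult_pos_iff, card_filter]

theorem sum_mult_le : ∑ σ ∈ A, mult V σ ≤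
    (A.filter (· ∈ cosetUnion V)).card + ∑ σ ∈ A, (mult V σ).choose 2 := by
  rw [card_filter_cosetUnion, ← sum_add_distrib]
  refine sum_le_sum fun σ _ => ?_
  rcases mult V σ with _ | p
  · simp
  · simpa using le_one_add_choose_two p

theorem card_add_sum_choose_two_le :
    (A.filter (· ∈ cosetUnion V)).card + ∑ σ ∈ A, (mult V σ).choose 2 ≤
      ∑ σ ∈ A, mult V σ + ∑ σ ∈ A, (mult V σ).choose 3 := by
  rw [card_filter_cosetUnion, ← sum_add_distrib, ← sum_add_distrib]
  refine sum_le_sum fun σ _ => ?_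
  rcases mult V σ with _ | p
  · simp
  · simpa using one_add_choose_two_le p

theorem sum_mult_add_sum_choose_three_le :
    ∑ σ ∈ A, mult V σ + ∑ σ ∈ A, (mult V σ).choose 3 ≤
      (A.filter (· ∈ cosetUnion V)).card + ∑ σ ∈ A, (mult V σ).choose 2 +
        ∑ σ ∈ A, (mult V σ).choose 4 := by
  rw [card_filter_cosetUnion, ← sum_add_distrib, ← sum_add_distrib, ← sum_add_distrib]
  refine sum_le_sum fun σ _ => ?_
  rcases mult V σ with _ | p
  · simp
  · simpa using add_choose_three_le p

end Bonferroni

theorem sum_mult_eq {n : ℕ} (V : Finset (Fin n × Fin n)) (A : Finset (Equiv.Perm (Fin n))) :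
    ∑ σ ∈ A, mult V σ = ∑ x ∈ V, (A.filter (· ∈ coset x)).card :=
  sum_card_bipartiteAbove_eq_sum_card_bipartiteBelow _

theorem sum_univ_mult {n : ℕ} (V : Finset (Fin n × Fin n)) :
    ∑ σ, mult V σ = V.card * (n - 1)! := by
  rw [sum_mult_eq, sum_congr rfl (g := fun _ => (n - 1)!), sum_const, smul_eq_mul]
  intro x _
  rw [filter_mem_eq_inter, univ_inter, card_coset]

theorem sum_univ_choose_mult {n : ℕ} (V : Finset (Fin n × Fin n)) (t : ℕ) :
    ∑ σ, (mult V σ).choose t = (cliques V t).card * (n - t)! := by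
  rw [sum_choose_mult, sum_congr rfl (g := fun _ => (n - t)!), sum_const, smul_eq_mul]
  intro S hS
  obtain ⟨-, hc, hp⟩ := mem_cliques.1 hS
  rw [filter_mem_eq_inter, univ_inter, card_meet hp, hc]

theorem filter_univ_cosetUnion {n : ℕ} (V : Finset (Fin n × Fin n)) :
    univ.filter (· ∈ cosetUnion V) = cosetUnion V := by
  rw [filter_mem_eq_inter, univ_inter]

theorem card_mul_factorial_le {n : ℕ} (V : Finset (Fin n × Fin n)) :
    V.card * (n - 1)! ≤ (cosetUnion V).card + (cliques V 2).card * (n - 2)! := by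
  have h := sum_mult_le V univ
  rwa [sum_univ_mult, sum_univ_choose_mult, filter_univ_cosetUnion] at h

theorem card_cosetUnion_add_le {n : ℕ} (V : Finset (Fin n × Fin n)) :
    (cosetUnion V).card + (cliques V 2).card * (n - 2)! ≤
      V.card * (n - 1)! + (cliques V 3).card * (n - 3)! := by
  have h := card_add_sum_choose_two_le V univ
  rwa [sum_univ_mult, sum_univ_choose_mult, sum_univ_choose_mult, filter_univ_cosetUnion] at h

theorem le_card_cosetUnion_add {n : ℕ} (V : Finset (Fin n × Fin n)) :
    V.card * (n - 1)! + (cliques V 3).card * (n - 3)! ≤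
      (cosetUnion V).card + (cliques V 2).card * (n - 2)! + (cliques V 4).card * (n - 4)! := by
  have h := sum_mult_add_sum_choose_three_le V univ
  rwa [sum_univ_mult, sum_univ_choose_mult, sum_univ_choose_mult, sum_univ_choose_mult,
    filter_univ_cosetUnion] at h

theorem card_cosetUnion_le {n : ℕ} (V : Finset (Fin n × Fin n)) :
    (cosetUnion V).card ≤ V.card * (n - 1)! :=
  card_biUnion_le_card_mul _ _ _ fun x _ => (card_coset x).le

/-! ### Permutations of the union disjoint from an outside permutation -/

theorem card_filter_disjoint_mem {n : ℕ} (π : Equiv.Perm (Fin n))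
    (F : Finset (Equiv.Perm (Fin n))) :
    ((univ.filter fun σ => DisjointPerms π σ).filter (· ∈ F)).card = disjFrom π F := by
  rw [disjFrom, filter_filter]
  congr 1
  ext σ
  simp [and_comm]

theorem sum_disjoint_mult {n : ℕ} {V : Finset (Fin n × Fin n)} {π : Equiv.Perm (Fin n)}
    (hπ : π ∉ cosetUnion V) :
    ∑ σ with DisjointPerms π σ, mult V σ = V.card * numD (n - 1) := by
  rw [sum_mult_eq, sum_congr rfl (g := fun _ => numD (n - 1)), sum_const, smul_eq_mul]
  intro x hx
  rw [card_filter_disjoint_mem, disjFrom_coset]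
  exact fun h => hπ (mem_cosetUnion.2 ⟨x, hx, h⟩)

theorem sum_disjoint_choose_mult {n : ℕ} (V : Finset (Fin n × Fin n)) (π : Equiv.Perm (Fin n))
    (t : ℕ) : ∑ σ with DisjointPerms π σ, (mult V σ).choose t =
      ∑ S ∈ cliques V t, disjFrom π (meet S) := by
  rw [sum_choose_mult]
  exact sum_congr rfl fun S _ => card_filter_disjoint_mem _ _

theorem disjFrom_cosetUnion_bounds {n : ℕ} (hn : 4 ≤ n) {V : Finset (Fin n × Fin n)}
    {π : Equiv.Perm (Fin n)} (hπ : π ∉ cosetUnion V) :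
    V.card * numD (n - 1) ≤
        disjFrom π (cosetUnion V) + (cliques V 2).card * (numD (n - 2) + (n - 3)!) ∧
      disjFrom π (cosetUnion V) + (cliques V 2).card * numD (n - 2) ≤
        V.card * numD (n - 1) + (cliques V 2).card * (n - 3)! + (cliques V 3).card * (n - 3)! := by
  have hout : ∀ x ∈ V, π ∉ coset x := fun x hx h => hπ (mem_cosetUnion.2 ⟨x, hx, h⟩)
  have h1 := sum_mult_le V (univ.filter fun σ => DisjointPerms π σ)
  have h2 := card_add_sum_choose_two_le V (univ.filter fun σ => DisjointPerms π σ)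
  rw [sum_disjoint_mult hπ, card_filter_disjoint_mem] at h1 h2
  rw [sum_disjoint_choose_mult] at h1 h2
  rw [sum_disjoint_choose_mult] at h2
  obtain ⟨m, rfl⟩ := Nat.exists_eq_add_of_le' hn
  -- Both bounds for a pair differ from D_{n-2} by at most (n-3)!: the lower one by d_{n-3}, the
  -- upper one by D_{n-3}.
  have hb : ∀ S ∈ cliques V 2, numD (m + 2) ≤ disjFrom π (meet S) + (m + 1)! ∧
      disjFrom π (meet S) ≤ numD (m + 2) + (m + 1)! := by
    intro S hS
    obtain ⟨x, hx, y, hy, hxy, rfl⟩ := exists_eq_pair_of_mem_cliques hS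
    obtain ⟨hl, hu⟩ := disjFrom_meet_pair hn (hout x hx) (hout y hy) hxy
    have h3 := numD_le_factorial m
    have h4 : numDerangements (m + 1) ≤ numD (m + 1) := Nat.le_add_right _ _
    have h5 : numD (m + 2) = numDerangements (m + 2) + numDerangements (m + 1) := rfl
    simp only [show m + 4 - 2 = m + 2 by omega, show m + 4 - 3 = m + 1 by omega] at hl hu
    omega
  have hle : ∑ S ∈ cliques V 2, disjFrom π (meet S) ≤
      (cliques V 2).card * (numD (m + 2) + (m + 1)!) :=
    sum_le_card_nsmul _ _ _ fun S hS => (hb S hS).2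
  have hge : (cliques V 2).card * numD (m + 2) ≤
      ∑ S ∈ cliques V 2, disjFrom π (meet S) + (cliques V 2).card * (m + 1)! := by
    rw [← smul_eq_mul, ← smul_eq_mul, ← sum_const, ← sum_const, ← sum_add_distrib]
    exact sum_le_sum fun S hS => (hb S hS).1
  have h3 : ∑ S ∈ cliques V 3, disjFrom π (meet S) ≤ (cliques V 3).card * (m + 1)! := by
    refine sum_le_card_nsmul _ _ _ fun S hS => ?_
    obtain ⟨-, hc, hp⟩ := mem_cliques.1 hS
    refine (card_filter_le _ _).trans ?_
    rw [card_meet hp, hc]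
    exact le_rfl
  change _ ≤ _ + _ * (numD (m + 2) + (m + 1)!) ∧ _ + _ * numD (m + 2) ≤
    _ + _ * (m + 1)! + _ * (m + 1)!
  rw [mul_add] at hle ⊢
  omega

/-! ### Counting disjoint pairs by adding permutations -/

theorem DisjointPerms.symm {n : ℕ} {π σ : Equiv.Perm (Fin n)} (h : DisjointPerms π σ) :
    DisjointPerms σ π := fun i => (h i).symm

theorem not_disjointPerms_of_mem_coset {n : ℕ} {x : Fin n × Fin n} {π σ : Equiv.Perm (Fin n)}
    (hπ : π ∈ coset x) (hσ : σ ∈ coset x) : ¬ DisjointPerms π σ := fun h =>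
  h x.1 ((mem_coset.1 hπ).trans (mem_coset.1 hσ).symm)

theorem disj_insert {n : ℕ} {π : Equiv.Perm (Fin n)} {F : Finset (Equiv.Perm (Fin n))}
    (hπ : π ∉ F) : disj (insert π F) = disj F + disjFrom π F := by
  have himg : ((powersetCard 1 F).image (insert π)).filter
      (fun P => ∀ α ∈ P, ∀ β ∈ P, α ≠ β → DisjointPerms α β) =
      (F.filter fun σ => DisjointPerms π σ).image fun σ => {π, σ} := by
    ext P
    simp only [mem_filter, mem_image, mem_powersetCard, card_eq_one]
    constructor
    · rintro ⟨⟨_, ⟨hF, σ, rfl⟩, rfl⟩, h⟩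
      rw [singleton_subset_iff] at hF
      refine ⟨σ, ⟨hF, h π (by simp) σ (by simp) fun e => hπ (e ▸ hF)⟩, rfl⟩
    · rintro ⟨σ, ⟨hF, h⟩, rfl⟩
      refine ⟨⟨{σ}, ⟨by simpa using hF, σ, rfl⟩, rfl⟩, ?_⟩
      simp only [mem_insert, mem_singleton]
      rintro α (rfl | rfl) β (rfl | rfl) hne
      · exact (hne rfl).elim
      · exact h
      · exact h.symm
      · exact (hne rfl).elim
  rw [disj, powersetCard_succ_insert hπ, filter_union, himg, card_union_of_disjoint, disj, disjFrom]
  · congr 1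
    refine card_image_of_injOn fun σ hσ τ hτ h => ?_
    have hσπ : σ ≠ π := fun e => hπ (e ▸ (mem_filter.1 hσ).1)
    have : σ ∈ ({π, τ} : Finset _) := by
      rw [← show ({π, σ} : Finset _) = {π, τ} from h]; simp
    simpa [hσπ] using this
  · rw [disjoint_left]
    intro P hP hP'
    obtain ⟨σ, -, rfl⟩ := mem_image.1 hP'
    exact hπ ((mem_powersetCard.1 (mem_filter.1 hP).1).1 (by simp))

theorem disjFrom_union {n : ℕ} {π : Equiv.Perm (Fin n)} {F R : Finset (Equiv.Perm (Fin n))}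
    (h : ∀ σ ∈ R, ¬ DisjointPerms π σ) : disjFrom π (F ∪ R) = disjFrom π F := by
  rw [disjFrom, filter_union, filter_eq_empty_iff.2 (fun σ hσ => h σ hσ), union_empty, disjFrom]

/-- Members of one coset agree at a point, so every new disjoint pair joins R to F. -/
theorem disj_union_of_subset_coset {n : ℕ} {x : Fin n × Fin n}
    {F R : Finset (Equiv.Perm (Fin n))} (hR : R ⊆ coset x) (hFR : Disjoint F R) :
    disj (F ∪ R) = disj F + ∑ π ∈ R, disjFrom π F := by
  induction R using Finset.induction_on with
  | empty => simp
  | insert π R hπ ih =>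
    rw [insert_subset_iff] at hR
    rw [disjoint_insert_right] at hFR
    rw [union_insert, disj_insert (by simp [hFR.1, hπ]), ih hR.2 hFR.2, sum_insert hπ,
      disjFrom_union fun σ hσ => not_disjointPerms_of_mem_coset hR.1 (hR.2 hσ)]
    ring

/-! ### The excess of a union of cosets -/

/-- The number of disjoint pairs in the union of the cosets `T_x`, `x ∈ V`, minus the value at
`|⋃ T_x|` of the linear function that gives this number for initial segments of the lexicographic
order whose size lies between `(|V| - 1) (n - 1)!` and `|V| (n - 1)!`. -/
def excess {n : ℕ} (V : Finset (Fin n × Fin n)) : ℤ :=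
  disj (cosetUnion V) - (((V.card : ℤ) - 1) * numD (n - 1) * (cosetUnion V).card -
    V.card.choose 2 * (n - 1)! * numD (n - 1))

theorem card_filter_add_sum_mult_sub_one {n : ℕ} (V : Finset (Fin n × Fin n))
    (A : Finset (Equiv.Perm (Fin n))) :
    (A.filter (· ∈ cosetUnion V)).card + ∑ σ ∈ A, (mult V σ - 1) = ∑ σ ∈ A, mult V σ := by
  rw [card_filter_cosetUnion, ← sum_add_distrib]
  refine sum_congr rfl fun σ _ => ?_
  split_ifs <;> omega

theorem cosetUnion_insert {n : ℕ} (x : Fin n × Fin n) (V : Finset (Fin n × Fin n)) :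
    cosetUnion (insert x V) = cosetUnion V ∪ (coset x \ cosetUnion V) := by
  rw [cosetUnion, biUnion_insert, union_sdiff_self_eq_union, union_comm]
  rfl

/-- Each new π sees |V| D_{n-1} disjoint permutations when these are counted with multiplicity; the
overcount is the sum of mult - 1 over them. Exchanging sums and comparing with the same overcount in
the size of the union gives the formula. Truncated subtraction makes the weight 0 outside the union.
-/
theorem excess_insert {n : ℕ} {x : Fin n × Fin n} {V : Finset (Fin n × Fin n)} (hx : x ∉ V) :
    excess (insert x V) = excess V + ∑ σ, ((mult V σ - 1 : ℕ) : ℤ) *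
      (numD (n - 1) - ((coset x \ cosetUnion V).filter fun π => DisjointPerms π σ).card) := by
  set R := coset x \ cosetUnion V with hR
  have hdisj : Disjoint (cosetUnion V) R := disjoint_sdiff
  have h1 : ∑ π ∈ R, disjFrom π (cosetUnion V) +
      ∑ σ, (mult V σ - 1) * (R.filter fun π => DisjointPerms π σ).card =
      R.card * (V.card * numD (n - 1)) := by
    have hswap : ∑ σ, (mult V σ - 1) * (R.filter fun π => DisjointPerms π σ).card =
        ∑ π ∈ R, ∑ σ with DisjointPerms π σ, (mult V σ - 1) := by
      simp only [sum_filter, card_filter, mul_sum, mul_ite, mul_one, mul_zero]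
      exact sum_comm
    rw [hswap, ← sum_add_distrib, ← smul_eq_mul, ← sum_const]
    refine sum_congr rfl fun π hπ => ?_
    rw [← sum_disjoint_mult (mem_sdiff.1 hπ).2, ← card_filter_disjoint_mem]
    exact card_filter_add_sum_mult_sub_one _ _
  have h2 := card_filter_add_sum_mult_sub_one V univ
  rw [sum_univ_mult, filter_univ_cosetUnion] at h2
  have h3 : (V.card + 1).choose 2 = V.card + V.card.choose 2 := by
    rw [Nat.choose_succ_succ' _ 1, Nat.choose_one_right]
  rw [excess, excess, cosetUnion_insert, ← hR,
    disj_union_of_subset_coset sdiff_subset hdisj, card_union_of_disjoint hdisj,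
    card_insert_of_notMem hx, h3]
  simp only [mul_sub, sum_sub_distrib, ← sum_mul]
  zify at h1 h2
  push_cast
  linear_combination h1 - (numD (n - 1) : ℤ) * h2

theorem card_filter_disjoint_le {n : ℕ} (x : Fin n × Fin n) (σ : Equiv.Perm (Fin n)) :
    ((coset x).filter fun π => DisjointPerms π σ).card ≤ numD (n - 1) := by
  have h : ((coset x).filter fun π => DisjointPerms π σ).card = disjFrom σ (coset x) := by
    rw [disjFrom]
    congr 1
    ext π
    simp only [mem_filter]
    exact and_congr_right fun _ => ⟨DisjointPerms.symm, DisjointPerms.symm⟩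
  rw [h]
  by_cases hσ : σ ∈ coset x
  · rw [disjFrom_coset_eq_zero hσ]
    exact Nat.zero_le _
  · rw [disjFrom_coset hσ]

theorem card_filter_sdiff_disjoint_le {n : ℕ} (x : Fin n × Fin n) (V : Finset (Fin n × Fin n))
    (σ : Equiv.Perm (Fin n)) :
    ((coset x \ cosetUnion V).filter fun π => DisjointPerms π σ).card ≤ numD (n - 1) :=
  (card_le_card (filter_subset_filter _ sdiff_subset)).trans (card_filter_disjoint_le x σ)

theorem excess_term_nonneg {n : ℕ} (x : Fin n × Fin n) (V : Finset (Fin n × Fin n))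
    (σ : Equiv.Perm (Fin n)) : (0 : ℤ) ≤ ((mult V σ - 1 : ℕ) : ℤ) *
      (numD (n - 1) - ((coset x \ cosetUnion V).filter fun π => DisjointPerms π σ).card) :=
  mul_nonneg (Nat.cast_nonneg _)
    (sub_nonneg.2 (Nat.cast_le.2 (card_filter_sdiff_disjoint_le x V σ)))

theorem excess_empty {n : ℕ} : excess (∅ : Finset (Fin n × Fin n)) = 0 := by
  simp [excess, cosetUnion, disj]

theorem excess_nonneg {n : ℕ} (V : Finset (Fin n × Fin n)) : 0 ≤ excess V := by
  induction V using Finset.induction_on with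
  | empty => rw [excess_empty]
  | insert x V hx ih =>
    rw [excess_insert hx]
    exact add_nonneg ih (sum_nonneg fun σ _ => excess_term_nonneg x V σ)

theorem excess_insert_pos {n : ℕ} {x : Fin n × Fin n} {V : Finset (Fin n × Fin n)} (hx : x ∉ V)
    {σ : Equiv.Perm (Fin n)} (hσ : 2 ≤ mult V σ)
    (h : ((coset x \ cosetUnion V).filter fun π => DisjointPerms π σ).card < numD (n - 1)) :
    0 < excess (insert x V) := by
  rw [excess_insert hx]
  refine add_pos_of_nonneg_of_pos (excess_nonneg V)
    (sum_pos' (fun σ _ => excess_term_nonneg x V σ) ⟨σ, mem_univ _, mul_pos ?_ ?_⟩)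
  · rw [Nat.cast_pos]; omega
  · rw [sub_pos, Nat.cast_lt]; exact h

/-! ### Canonical unions -/

theorem mult_le_one {n : ℕ} {U : Finset (Fin n × Fin n)}
    (hU : (U : Set (Fin n × Fin n)).PairwiseDisjoint coset) (σ : Equiv.Perm (Fin n)) :
    mult U σ ≤ 1 := by
  rw [mult, card_le_one]
  intro x hx y hy
  rw [mem_filter] at hx hy
  by_contra hne
  exact disjoint_left.1 (hU hx.1 hy.1 hne) hx.2 hy.2

theorem excess_insert_of_pairwiseDisjoint {n : ℕ} {x : Fin n × Fin n}
    {U : Finset (Fin n × Fin n)} (hx : x ∉ U)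
    (hU : (U : Set (Fin n × Fin n)).PairwiseDisjoint coset) :
    excess (insert x U) = excess U := by
  rw [excess_insert hx, sum_eq_zero, add_zero]
  intro σ _
  rw [Nat.sub_eq_zero_of_le (mult_le_one hU σ), Nat.cast_zero, zero_mul]

theorem excess_of_pairwiseDisjoint {n : ℕ} {U : Finset (Fin n × Fin n)}
    (hU : (U : Set (Fin n × Fin n)).PairwiseDisjoint coset) : excess U = 0 := by
  induction U using Finset.induction_on with
  | empty => exact excess_empty
  | insert x U hx ih =>
    have hU' := hU.subset (by exact_mod_cast subset_insert x U)
    rw [excess_insert_of_pairwiseDisjoint hx hU', ih hU']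

theorem excess_of_isCanonical {n : ℕ} {V : Finset (Fin n × Fin n)} (h : IsCanonical V) :
    excess V = 0 := by
  obtain ⟨U, hUV, hc, hU⟩ := h
  rcases eq_or_ne U V with rfl | hne
  · exact excess_of_pairwiseDisjoint hU
  · have hlt := card_lt_card (hUV.ssubset_of_ne hne)
    have h1 : (V \ U).card = 1 := by rw [card_sdiff_of_subset hUV]; omega
    obtain ⟨x, hx⟩ := card_eq_one.1 h1
    have hxU : x ∉ U := (mem_sdiff.1 (hx ▸ mem_singleton_self x)).2
    have hV : V = insert x U := by
      rw [← sdiff_union_of_subset hUV, hx, singleton_union]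
    rw [hV, excess_insert_of_pairwiseDisjoint hxU hU, excess_of_pairwiseDisjoint hU]

theorem exists_compat_of_not_pairwiseDisjoint {n : ℕ} {U : Finset (Fin n × Fin n)}
    (h : ¬ (U : Set (Fin n × Fin n)).PairwiseDisjoint coset) :
    ∃ x ∈ U, ∃ y ∈ U, Compat x y := by
  by_contra! hc
  refine h fun x hx y hy hxy => disjoint_left.2 fun π hπ hπ' => ?_
  exact hc x hx y hy (compat_of_mem_coset hxy hπ hπ')

/-- A graph with neither a triangle nor two disjoint edges is a star. -/
theorem exists_triangle_or_matching {n : ℕ} {V : Finset (Fin n × Fin n)} (h : ¬ IsCanonical V) :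
    (∃ x ∈ V, ∃ y ∈ V, ∃ z ∈ V, Compat x y ∧ Compat x z ∧ Compat y z) ∨
    ∃ x ∈ V, ∃ w ∈ V, ∃ y ∈ V, ∃ z ∈ V, Compat x w ∧ Compat y z ∧
      x ≠ y ∧ x ≠ z ∧ w ≠ y ∧ w ≠ z := by
  -- Not being canonical means that deleting any one vertex leaves an edge.
  have key : ∀ y ∈ V, ∃ a ∈ V, ∃ b ∈ V, a ≠ y ∧ b ≠ y ∧ Compat a b := by
    intro y hy
    have hnd : ¬ ((V.erase y : Finset _) : Set (Fin n × Fin n)).PairwiseDisjoint coset :=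
      fun hd => h ⟨V.erase y, erase_subset _ _, by rw [card_erase_of_mem hy]; omega, hd⟩
    obtain ⟨a, ha, b, hb, hab⟩ := exists_compat_of_not_pairwiseDisjoint hnd
    rw [mem_erase] at ha hb
    exact ⟨a, ha.2, b, hb.2, ha.1, hb.1, hab⟩
  have hnd : ¬ (V : Set (Fin n × Fin n)).PairwiseDisjoint coset :=
    fun hd => h ⟨V, Subset.rfl, by omega, hd⟩
  obtain ⟨y, hy, z, hz, hyz⟩ := exists_compat_of_not_pairwiseDisjoint hnd
  by_contra! hcon
  obtain ⟨htri, hmat⟩ := hcon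
  have key2 : ∀ y ∈ V, ∀ z ∈ V, Compat y z → ∃ b ∈ V, b ≠ y ∧ Compat z b := by
    intro y hy z hz hyz
    obtain ⟨a, ha, b, hb, hay, hby, hab⟩ := key y hy
    by_cases haz : a = z
    · exact ⟨b, hb, hby, haz ▸ hab⟩
    · exact ⟨a, ha, hay, (hmat a ha b hb y hy z hz hab hyz hay haz hby) ▸ hab.symm⟩
  obtain ⟨b, hb, hby, hzb⟩ := key2 y hy z hz hyz
  obtain ⟨c, hc, hcz, hyc⟩ := key2 z hz y hy hyz.symm
  by_cases hbc : b = c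
  · subst hbc
    exact htri y hy z hz b hb hyz hyc hzb
  · exact hbc (hmat z hz b hb y hy c hc hzb hyc hyz.ne.symm hcz.symm hby)

theorem two_le_mult {n : ℕ} {V : Finset (Fin n × Fin n)} {y z : Fin n × Fin n} (hy : y ∈ V)
    (hz : z ∈ V) (hyz : y ≠ z) {σ : Equiv.Perm (Fin n)} (hσy : σ ∈ coset y) (hσz : σ ∈ coset z) :
    2 ≤ mult V σ := by
  rw [mult, ← card_pair hyz]
  refine card_le_card fun x hx => ?_
  rw [mem_insert, mem_singleton] at hx
  rcases hx with rfl | rfl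
  · exact mem_filter.2 ⟨hy, hσy⟩
  · exact mem_filter.2 ⟨hz, hσz⟩

/-- Take σ in all three cosets and add T_x last: σ lies in T_x, so it is disjoint from no new
permutation. -/
theorem excess_pos_of_triangle {n : ℕ} (hn : 2 ≤ n) {V : Finset (Fin n × Fin n)}
    {x y z : Fin n × Fin n} (hx : x ∈ V) (hy : y ∈ V) (hz : z ∈ V) (hxy : Compat x y)
    (hxz : Compat x z) (hyz : Compat y z) : 0 < excess V := by
  have hp : (({x, y, z} : Finset (Fin n × Fin n)) : Set (Fin n × Fin n)).Pairwise Compat := by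
    intro a ha b hb hab
    simp only [coe_insert, coe_singleton, Set.mem_insert_iff, Set.mem_singleton_iff] at ha hb
    rcases ha with rfl | rfl | rfl <;> rcases hb with rfl | rfl | rfl <;>
      first
      | exact (hab rfl).elim
      | assumption
      | exact Compat.symm (by assumption)
  obtain ⟨σ, hσ⟩ := exists_mem_meet hp
  rw [mem_meet] at hσ
  rw [← insert_erase hx]
  refine excess_insert_pos (notMem_erase _ _) (σ := σ)
    (two_le_mult (mem_erase.2 ⟨hxy.ne.symm, hy⟩) (mem_erase.2 ⟨hxz.ne.symm, hz⟩) hyz.ne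
      (hσ y (by simp)) (hσ z (by simp))) ?_
  rw [card_eq_zero.2]
  · obtain ⟨m, rfl⟩ := Nat.exists_eq_add_of_le' hn
    exact numD_pos m
  · rw [filter_eq_empty_iff]
    intro π hπ
    exact not_disjointPerms_of_mem_coset (mem_sdiff.1 hπ).1 (hσ x (by simp))

theorem card_meet_inter_coset_le {n : ℕ} {S : Finset (Fin n × Fin n)} {x : Fin n × Fin n}
    (hx : x ∉ S) : ((meet S).filter (· ∈ coset x)).card ≤ (n - (S.card + 1))! := by
  rcases ((meet S).filter (· ∈ coset x)).eq_empty_or_nonempty with h | ⟨π, hπ⟩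
  · rw [h]; exact Nat.zero_le _
  · have he : (meet S).filter (· ∈ coset x) = meet (insert x S) := by
      ext σ
      simp only [mem_filter, mem_meet, mem_insert, forall_eq_or_imp]
      exact and_comm
    rw [he] at hπ ⊢
    rw [mem_meet] at hπ
    rw [card_meet fun a ha b hb hab => compat_of_mem_coset hab (hπ a ha) (hπ b hb),
      card_insert_of_notMem hx]

/-- Add T_x last, and take σ in T_y ∩ T_z disjoint from some π in T_x ∩ T_w. As π is already covered
by T_w, it is missing from the new permutations disjoint from σ. -/
theorem excess_pos_of_matching {n : ℕ} (hn : 5 ≤ n) {V : Finset (Fin n × Fin n)}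
    {x w y z : Fin n × Fin n} (hx : x ∈ V) (hw : w ∈ V) (hy : y ∈ V) (hz : z ∈ V)
    (hxw : Compat x w) (hyz : Compat y z) (hxy : x ≠ y) (hxz : x ≠ z) (hwy : w ≠ y)
    (hwz : w ≠ z) : 0 < excess V := by
  obtain ⟨m, rfl⟩ := Nat.exists_eq_add_of_le' hn
  -- T_x ∩ T_w has (n-2)! members, of which T_y and T_z take at most (n-3)! each; 2(n-3)! < (n-2)!
  -- because n ≥ 5.
  obtain ⟨π, hπ, hπyz⟩ : ∃ π ∈ meet {x, w}, π ∉ (meet {x, w}).filter (· ∈ coset y) ∪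
      (meet {x, w}).filter (· ∈ coset z) := by
    refine exists_mem_notMem_of_card_lt_card ?_
    have hy' := card_meet_inter_coset_le (S := {x, w}) (x := y) (by simp [hxy.symm, hwy.symm])
    have hz' := card_meet_inter_coset_le (S := {x, w}) (x := z) (by simp [hxz.symm, hwz.symm])
    refine (card_union_le _ _).trans_lt ((add_le_add hy' hz').trans_lt ?_)
    rw [card_meet (pair_pairwise_compat hxw), card_pair hxw.ne]
    change (m + 2)! + (m + 2)! < (m + 3)!
    rw [Nat.factorial_succ (m + 2)]
    have := Nat.factorial_pos (m + 2)
    nlinarith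
  have hπy : π ∉ coset y := fun h => hπyz (mem_union_left _ (mem_filter.2 ⟨hπ, h⟩))
  have hπz : π ∉ coset z := fun h => hπyz (mem_union_right _ (mem_filter.2 ⟨hπ, h⟩))
  rw [mem_meet] at hπ
  obtain ⟨σ, hσ⟩ : ((meet {y, z}).filter fun σ => DisjointPerms π σ).Nonempty := by
    rw [← card_pos]
    exact (numDerangements_pos (m + 1)).trans_le
      (disjFrom_meet_pair (by omega) hπy hπz hyz).1
  rw [mem_filter, mem_meet] at hσ
  obtain ⟨hσ, hπσ⟩ := hσ
  rw [← insert_erase hx]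
  refine excess_insert_pos (notMem_erase _ _) (σ := σ)
    (two_le_mult (mem_erase.2 ⟨hxy.symm, hy⟩) (mem_erase.2 ⟨hxz.symm, hz⟩) hyz.ne
      (hσ y (by simp)) (hσ z (by simp))) ?_
  refine (card_lt_card ?_).trans_le (card_filter_disjoint_le x σ)
  rw [ssubset_iff_of_subset (filter_subset_filter _ sdiff_subset)]
  refine ⟨π, mem_filter.2 ⟨hπ x (by simp), hπσ⟩, fun h => ?_⟩
  exact (mem_sdiff.1 (mem_filter.1 h).1).2 (mem_cosetUnion.2
    ⟨w, mem_erase.2 ⟨hxw.ne.symm, hw⟩, hπ w (by simp)⟩)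

theorem excess_eq_zero_iff {n : ℕ} (hn : 5 ≤ n) (V : Finset (Fin n × Fin n)) :
    excess V = 0 ↔ IsCanonical V := by
  refine ⟨fun h => ?_, excess_of_isCanonical⟩
  by_contra hc
  rcases exists_triangle_or_matching hc with ⟨x, hx, y, hy, z, hz, h1, h2, h3⟩ |
    ⟨x, hx, w, hw, y, hy, z, hz, h1, h2, h3, h4, h5, h6⟩
  · exact (excess_pos_of_triangle (by omega) hx hy hz h1 h2 h3).ne' h
  · exact (excess_pos_of_matching hn hx hw hy hz h1 h2 h3 h4 h5 h6).ne' h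

/-! ### An upper bound for the excess -/

theorem sum_coset_choose_mult_le {n : ℕ} {x : Fin n × Fin n} {V : Finset (Fin n × Fin n)}
    (hx : x ∉ V) : ∑ σ ∈ coset x, (mult V σ).choose 2 ≤ (cliques V 2).card * (n - 3)! := by
  rw [sum_choose_mult]
  refine sum_le_card_nsmul _ _ _ fun S hS => ?_
  obtain ⟨hSV, hc, -⟩ := mem_cliques.1 hS
  have h := card_meet_inter_coset_le (S := S) (x := x) fun h => hx (hSV h)
  rw [hc] at h
  refine (card_le_card fun σ hσ => ?_).trans h
  rw [mem_filter] at hσ ⊢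
  exact hσ.symm

theorem card_coset_inter_cosetUnion_le {n : ℕ} {x : Fin n × Fin n} {V : Finset (Fin n × Fin n)}
    (hx : x ∉ V) :
    ((coset x).filter (· ∈ cosetUnion V)).card ≤ (V.filter fun y => Compat x y).card * (n - 2)! := by
  refine (card_le_card (t := (V.filter fun y => Compat x y).biUnion fun y => meet {x, y})
    fun σ hσ => ?_).trans (card_biUnion_le_card_mul _ _ _ fun y hy => ?_)
  · obtain ⟨hσx, hσ⟩ := mem_filter.1 hσ
    obtain ⟨y, hy, hσy⟩ := mem_cosetUnion.1 hσ
    have hxy : x ≠ y := fun e => hx (e ▸ hy)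
    refine mem_biUnion.2 ⟨y, mem_filter.2 ⟨hy, compat_of_mem_coset hxy hσx hσy⟩, ?_⟩
    simp [mem_meet, hσx, hσy]
  · have hxy := (mem_filter.1 hy).2
    rw [card_meet (pair_pairwise_compat hxy), card_pair hxy.ne]

theorem card_cliques_two_insert {n : ℕ} {x : Fin n × Fin n} {V : Finset (Fin n × Fin n)}
    (hx : x ∉ V) :
    (cliques V 2).card + (V.filter fun y => Compat x y).card ≤ (cliques (insert x V) 2).card := by
  have hinj : Set.InjOn (fun y => ({x, y} : Finset (Fin n × Fin n)))
      (V.filter fun y => Compat x y : Finset _) := by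
    intro y hy z hz h
    have hyx : y ≠ x := fun e => hx (e ▸ (mem_filter.1 hy).1)
    have : y ∈ ({x, z} : Finset _) := by
      rw [← show ({x, y} : Finset _) = {x, z} from h]; simp
    simpa [hyx] using this
  rw [← card_image_of_injOn hinj, ← card_union_of_disjoint]
  · refine card_le_card (union_subset (fun S hS => ?_) fun S hS => ?_)
    · obtain ⟨h1, h2, h3⟩ := mem_cliques.1 hS
      exact mem_cliques.2 ⟨h1.trans (subset_insert _ _), h2, h3⟩
    · obtain ⟨y, hy, rfl⟩ := mem_image.1 hS
      obtain ⟨hy, hxy⟩ := mem_filter.1 hy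
      refine mem_cliques.2 ⟨?_, card_pair hxy.ne, pair_pairwise_compat hxy⟩
      exact insert_subset_insert _ (singleton_subset_iff.2 hy)
  · rw [disjoint_left]
    intro S hS hS'
    obtain ⟨y, -, rfl⟩ := mem_image.1 hS'
    exact hx ((mem_cliques.1 hS).1 (by simp))

theorem sub_one_le_choose_two (m : ℕ) : m - 1 ≤ m.choose 2 := by
  rcases m with _ | p
  · simp
  · have := le_one_add_choose_two p
    omega

/-- A permutation outside T_x can only lose those disjoint partners in T_x that the union already
covers. -/
theorem numD_sub_le {n : ℕ} {x : Fin n × Fin n} {V : Finset (Fin n × Fin n)}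
    {σ : Equiv.Perm (Fin n)} (hσ : σ ∉ coset x) :
    numD (n - 1) ≤ ((coset x \ cosetUnion V).filter fun π => DisjointPerms π σ).card +
      ((coset x).filter (· ∈ cosetUnion V)).card := by
  rw [← disjFrom_coset hσ, disjFrom]
  refine (card_le_card fun π hπ => ?_).trans (card_union_le _ _)
  obtain ⟨hπx, hd⟩ := mem_filter.1 hπ
  by_cases h : π ∈ cosetUnion V
  · exact mem_union_right _ (mem_filter.2 ⟨hπx, h⟩)
  · exact mem_union_left _ (mem_filter.2 ⟨mem_sdiff.2 ⟨hπx, h⟩, hd.symm⟩)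

theorem excess_insert_le {n : ℕ} (hn : 2 ≤ n) {x : Fin n × Fin n} {V : Finset (Fin n × Fin n)}
    (hx : x ∉ V) :
    excess (insert x V) ≤ excess V + (cliques V 2).card * (n - 3)! * (n - 1)! +
      (V.filter fun y => Compat x y).card * (n - 2)! * ((cliques V 2).card * (n - 2)!) := by
  set M := ((coset x).filter (· ∈ cosetUnion V)).card with hM
  -- If σ lies in T_x, the second factor is bounded trivially by (n-1)!, and triple intersections
  -- make such σ rare; otherwise the factor is at most the overlap M.
  have hterm : ∀ σ, ((mult V σ - 1 : ℕ) : ℤ) *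
      (numD (n - 1) - ((coset x \ cosetUnion V).filter fun π => DisjointPerms π σ).card) ≤
      (if σ ∈ coset x then ((mult V σ).choose 2 : ℤ) * (n - 1)! else 0) +
        ((mult V σ - 1 : ℕ) : ℤ) * M := by
    intro σ
    by_cases hσ : σ ∈ coset x
    · rw [if_pos hσ]
      have h1 : ((mult V σ - 1 : ℕ) : ℤ) ≤ (mult V σ).choose 2 := by
        exact_mod_cast sub_one_le_choose_two _
      have h2 : (numD (n - 1) : ℤ) ≤ (n - 1)! := by
        obtain ⟨m, rfl⟩ := Nat.exists_eq_add_of_le' hn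
        exact_mod_cast numD_le_factorial m
      have h3 : (0 : ℤ) ≤ ((mult V σ - 1 : ℕ) : ℤ) * M := by positivity
      refine le_trans ?_ (le_add_of_nonneg_right h3)
      exact mul_le_mul h1 ((sub_le_self _ (Nat.cast_nonneg _)).trans h2)
        (sub_nonneg.2 (Nat.cast_le.2 (card_filter_sdiff_disjoint_le x V σ))) (Nat.cast_nonneg _)
    · rw [if_neg hσ, zero_add]
      refine mul_le_mul_of_nonneg_left ?_ (Nat.cast_nonneg _)
      rw [sub_le_iff_le_add']
      exact_mod_cast numD_sub_le hσ
  have hs1 : ∑ σ, (if σ ∈ coset x then ((mult V σ).choose 2 : ℤ) * (n - 1)! else 0) ≤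
      (cliques V 2).card * (n - 3)! * (n - 1)! := by
    rw [sum_ite_mem, univ_inter, ← sum_mul]
    refine mul_le_mul_of_nonneg_right ?_ (Nat.cast_nonneg _)
    exact_mod_cast sum_coset_choose_mult_le hx
  have hs2 : ∑ σ, ((mult V σ - 1 : ℕ) : ℤ) * M ≤
      (V.filter fun y => Compat x y).card * (n - 2)! * ((cliques V 2).card * (n - 2)!) := by
    rw [← sum_mul, mul_comm]
    have h1 := card_filter_add_sum_mult_sub_one V univ
    rw [sum_univ_mult, filter_univ_cosetUnion] at h1
    have h2 := card_mul_factorial_le V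
    have h3 : ∑ σ, (mult V σ - 1) ≤ (cliques V 2).card * (n - 2)! := by omega
    exact_mod_cast Nat.mul_le_mul (card_coset_inter_cosetUnion_le hx) h3
  rw [excess_insert hx, add_assoc]
  refine add_le_add le_rfl ((sum_le_sum fun σ _ => hterm σ).trans ?_)
  rw [sum_add_distrib]
  exact add_le_add hs1 hs2

theorem excess_le {n : ℕ} (hn : 2 ≤ n) (V : Finset (Fin n × Fin n)) :
    excess V ≤ (cliques V 2).card ^ 2 * (n - 2)! ^ 2 +
      V.card * (cliques V 2).card * ((n - 1)! * (n - 3)!) := by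
  induction V using Finset.induction_on with
  | empty => rw [excess_empty]; positivity
  | insert x V hx ih =>
    refine (excess_insert_le hn hx).trans ?_
    have h : ((cliques V 2).card : ℤ) + (V.filter fun y => Compat x y).card ≤
        (cliques (insert x V) 2).card := by
      exact_mod_cast card_cliques_two_insert hx
    rw [card_insert_of_notMem hx]
    push_cast
    -- With e edges before and deg x new ones, e² + e·deg x ≤ (e + deg x)², so the quadratic term
    -- absorbs the increment.
    have h1 : ((cliques V 2).card : ℤ) * ((cliques V 2).card + (V.filter fun y => Compat x y).card)
        ≤ (cliques (insert x V) 2).card ^ 2 := by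
      rw [sq]
      exact mul_le_mul (by linarith) h (by positivity) (by positivity)
    have h2 : ((V.card : ℤ) + 1) * (cliques V 2).card ≤
        (V.card + 1) * (cliques (insert x V) 2).card :=
      mul_le_mul_of_nonneg_left (by linarith) (by positivity)
    have h3 := mul_le_mul_of_nonneg_right h1 (by positivity : (0 : ℤ) ≤ ((n - 2)! : ℤ) ^ 2)
    have h4 := mul_le_mul_of_nonneg_right h2
      (by positivity : (0 : ℤ) ≤ ((n - 1)! : ℤ) * (n - 3)!)
    linarith

/-! ### Initial segments of the lexicographic order -/

theorem lexLT_iff {n : ℕ} (π σ : Equiv.Perm (Fin n)) :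
    LexLT π σ ↔ toLex (π : Fin n → Fin n) < toLex (σ : Fin n → Fin n) :=
  exists_congr fun _ => and_comm

/-- The number of predecessors in the lexicographic order. -/
def lexRank {n : ℕ} (π : Equiv.Perm (Fin n)) : ℕ := (univ.filter fun σ => LexLT σ π).card

theorem lexRank_lt_of_lexLT {n : ℕ} {π σ : Equiv.Perm (Fin n)} (h : LexLT π σ) :
    lexRank π < lexRank σ := by
  refine card_lt_card ((ssubset_iff_of_subset fun τ hτ => ?_).2 ⟨π, ?_, ?_⟩)
  · rw [mem_filter, lexLT_iff] at hτ
    rw [lexLT_iff] at h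
    exact mem_filter.2 ⟨mem_univ _, (lexLT_iff _ _).2 (hτ.2.trans h)⟩
  · exact mem_filter.2 ⟨mem_univ _, h⟩
  · rw [mem_filter, lexLT_iff]
    exact fun h => lt_irrefl _ h.2

theorem lexRank_injective {n : ℕ} :
    Function.Injective (lexRank : Equiv.Perm (Fin n) → ℕ) := by
  intro π σ h
  rcases lt_trichotomy (toLex (π : Fin n → Fin n)) (toLex (σ : Fin n → Fin n)) with h1 | h1 | h1
  · exact ((lexRank_lt_of_lexLT ((lexLT_iff _ _).2 h1)).ne h).elim
  · exact DFunLike.coe_injective (toLex.injective h1)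
  · exact ((lexRank_lt_of_lexLT ((lexLT_iff _ _).2 h1)).ne' h).elim

theorem lexRank_lt_factorial {n : ℕ} (π : Equiv.Perm (Fin n)) : lexRank π < n ! := by
  have h : (univ : Finset (Equiv.Perm (Fin n))).card = n ! := by
    rw [card_univ, Fintype.card_perm, Fintype.card_fin]
  rw [← h, lexRank]
  refine card_lt_card (filter_ssubset.2 ⟨π, mem_univ _, ?_⟩)
  rw [lexLT_iff]
  exact lt_irrefl _

theorem mem_lexInitial {n s : ℕ} {π : Equiv.Perm (Fin n)} :
    π ∈ lexInitial n s ↔ lexRank π < s := by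
  rw [lexInitial, mem_filter]
  exact and_iff_right (mem_univ _)

theorem card_lexInitial {n s : ℕ} (hs : s ≤ n !) : (lexInitial n s).card = s := by
  have himg : (univ : Finset (Equiv.Perm (Fin n))).image lexRank = range n ! := by
    refine eq_of_subset_of_card_le (fun r hr => ?_) ?_
    · obtain ⟨π, -, rfl⟩ := mem_image.1 hr
      exact mem_range.2 (lexRank_lt_factorial π)
    · rw [card_image_of_injective _ lexRank_injective, card_range, card_univ, Fintype.card_perm,
        Fintype.card_fin]
  have h : (lexInitial n s).image lexRank = range s := by
    ext r
    rw [mem_image, mem_range]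
    constructor
    · rintro ⟨π, hπ, rfl⟩
      exact mem_lexInitial.1 hπ
    · intro hr
      obtain ⟨π, -, rfl⟩ := mem_image.1 (himg ▸ mem_range.2 (hr.trans_le hs))
      exact ⟨π, mem_lexInitial.2 hr, rfl⟩
  rw [← card_image_of_injective _ lexRank_injective, h, card_range]

/-- The first `a` cells of the first row. -/
def rowCells (m a : ℕ) : Finset (Fin (m + 1) × Fin (m + 1)) :=
  (univ.filter fun j : Fin (m + 1) => (j : ℕ) < a).image fun j => (0, j)

theorem mem_cosetUnion_rowCells {m a : ℕ} {π : Equiv.Perm (Fin (m + 1))} :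
    π ∈ cosetUnion (rowCells m a) ↔ (π 0 : ℕ) < a := by
  simp [mem_cosetUnion, rowCells, mem_coset]

theorem pairwiseDisjoint_rowCells (m a : ℕ) :
    (rowCells m a : Set (Fin (m + 1) × Fin (m + 1))).PairwiseDisjoint coset := by
  intro x hx y hy hxy
  refine disjoint_left.2 fun π hπ hπ' => (compat_of_mem_coset hxy hπ hπ').1 ?_
  simp only [rowCells, coe_image, Set.mem_image] at hx hy
  obtain ⟨_, -, rfl⟩ := hx
  obtain ⟨_, -, rfl⟩ := hy
  rfl

theorem card_rowCells {m a : ℕ} (ha : a ≤ m + 1) : (rowCells m a).card = a := by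
  rw [rowCells, card_image_of_injective _ (Prod.mk_right_injective 0), Fin.card_filter_val_lt,
    min_eq_right ha]

theorem card_cosetUnion_rowCells {m a : ℕ} (ha : a ≤ m + 1) :
    (cosetUnion (rowCells m a)).card = a * m ! := by
  rw [cosetUnion, card_biUnion (pairwiseDisjoint_rowCells m a),
    sum_congr rfl fun x _ => card_coset x, sum_const, card_rowCells ha, smul_eq_mul]
  rfl

theorem disjFrom_cosetUnion_of_pairwiseDisjoint {n : ℕ} {U : Finset (Fin n × Fin n)}
    (hU : (U : Set (Fin n × Fin n)).PairwiseDisjoint coset) {π : Equiv.Perm (Fin n)}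
    (hπ : π ∉ cosetUnion U) : disjFrom π (cosetUnion U) = U.card * numD (n - 1) := by
  rw [← sum_disjoint_mult hπ, ← card_filter_add_sum_mult_sub_one, card_filter_disjoint_mem,
    sum_eq_zero, add_zero]
  exact fun σ _ => Nat.sub_eq_zero_of_le (mult_le_one hU σ)

theorem mul_factorial_le_lexRank {m : ℕ} (π : Equiv.Perm (Fin (m + 1))) :
    (π 0 : ℕ) * m ! ≤ lexRank π := by
  rw [← card_cosetUnion_rowCells (π 0).isLt.le]
  refine card_le_card fun σ hσ => mem_filter.2 ⟨mem_univ _, 0, ?_, fun i hi => ?_⟩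
  · exact mem_cosetUnion_rowCells.1 hσ
  · exact absurd hi (Fin.not_lt_zero i)

theorem lexRank_lt_mul_factorial {m : ℕ} (π : Equiv.Perm (Fin (m + 1))) :
    lexRank π < ((π 0 : ℕ) + 1) * m ! := by
  rw [← card_cosetUnion_rowCells (Nat.succ_le_of_lt (π 0).isLt)]
  refine card_lt_card ((ssubset_iff_of_subset fun σ hσ => ?_).2 ⟨π, ?_, ?_⟩)
  · obtain ⟨-, k, hk, hlt⟩ := mem_filter.1 hσ
    rw [mem_cosetUnion_rowCells, Nat.lt_succ_iff]
    rcases eq_or_ne k 0 with rfl | hk0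
    · exact hk.le
    · rw [hlt 0 (Fin.pos_iff_ne_zero.2 hk0)]
  · rw [mem_cosetUnion_rowCells]
    exact Nat.lt_succ_self _
  · rw [mem_filter, lexLT_iff]
    exact fun h => lt_irrefl _ h.2

/-- The segment is a full cosets of the first row plus a remainder inside the next one, each member
of which is disjoint from exactly a·D_m earlier permutations. -/
theorem disj_lexInitial {m a s : ℕ} (ha : a < m + 1) (hs : a * m ! ≤ s)
    (hs' : s ≤ (a + 1) * m !) : (disj (lexInitial (m + 1) s) : ℤ) =
      a * numD m * s - (a + 1).choose 2 * m ! * numD m := by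
  have hsn : s ≤ (m + 1)! := by
    rw [Nat.factorial_succ]
    exact hs'.trans (Nat.mul_le_mul_right _ ha)
  have hsub : cosetUnion (rowCells m a) ⊆ lexInitial (m + 1) s := by
    intro π hπ
    rw [mem_cosetUnion_rowCells] at hπ
    exact mem_lexInitial.2 ((lexRank_lt_mul_factorial π).trans_le
      ((Nat.mul_le_mul_right _ hπ).trans hs))
  set R := lexInitial (m + 1) s \ cosetUnion (rowCells m a) with hR
  have hRc : R ⊆ coset (0, ⟨a, ha⟩) := by
    intro π hπ
    rw [hR, mem_sdiff, mem_lexInitial, mem_cosetUnion_rowCells, not_lt] at hπ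
    have h1 : (π 0 : ℕ) * m ! < (a + 1) * m ! :=
      (mul_factorial_le_lexRank π).trans_lt (hπ.1.trans_le hs')
    have h2 : (π 0 : ℕ) < a + 1 := lt_of_mul_lt_mul_right h1 (Nat.zero_le _)
    rw [mem_coset]
    exact Fin.ext (le_antisymm (Nat.lt_succ_iff.1 h2) hπ.2)
  have hcard : R.card + a * m ! = s := by
    rw [← card_cosetUnion_rowCells ha.le, hR, card_sdiff_add_card_eq_card hsub,
      card_lexInitial hsn]
  have hrow := excess_of_pairwiseDisjoint (pairwiseDisjoint_rowCells m a)
  rw [excess, card_cosetUnion_rowCells ha.le, card_rowCells ha.le] at hrow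
  have hdisj : disj (lexInitial (m + 1) s) =
      disj (cosetUnion (rowCells m a)) + R.card * (a * numD m) := by
    rw [← union_sdiff_of_subset hsub, disj_union_of_subset_coset hRc disjoint_sdiff,
      sum_congr rfl fun π hπ => disjFrom_cosetUnion_of_pairwiseDisjoint
        (pairwiseDisjoint_rowCells m a) (mem_sdiff.1 hπ).2, sum_const, card_rowCells ha.le,
      smul_eq_mul]
    rfl
  have hch : (a + 1).choose 2 = a + a.choose 2 := by
    rw [Nat.choose_succ_succ' _ 1, Nat.choose_one_right]
  rw [hdisj, hch, ← hcard]
  simp only [Nat.add_sub_cancel] at hrow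
  push_cast at hrow ⊢
  linear_combination hrow

end PermSupersat

open PermSupersat

/-! ### Assembly of the estimates -/

theorem mainTheorem7 :
    ∃ c : ℝ, 0 < c ∧
      ∀ (n : ℕ) (V : Finset (Fin n × Fin n)) (k₁ k₂ k₃ k₄ : ℕ),
        k₁ = V.card → k₂ = cliqueCount V 2 → k₃ = cliqueCount V 3 → k₄ = cliqueCount V 4 →
        2 ≤ k₁ → (k₁ : ℝ) ≤ c * Real.sqrt n →
        -- the size of the union
        (|((cosetUnion V).card : ℝ) -
            ((k₁ : ℝ) * (n - 1)! - (k₂ : ℝ) * (n - 2)! + (k₃ : ℝ) * (n - 3)!)|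
          ≤ (k₄ : ℝ) * (n - 4)!) ∧
        -- disjoint pairs with a permutation outside the union
        (∀ π : Equiv.Perm (Fin n), π ∉ cosetUnion V →
          |(disjFrom π (cosetUnion V) : ℝ) -
              ((k₁ : ℝ) * numD (n - 1) - (k₂ : ℝ) * numD (n - 2))|
            ≤ 3 * (k₁ : ℝ) * (k₂ : ℝ) * (n - 3)!) ∧
        -- disjoint pairs within the union
        (|(disj (cosetUnion V) : ℝ) -
            ((k₁.choose 2 : ℝ) * (n - 1)! * numD (n - 1) -
              ((k₁ : ℝ) - 1) * (k₂ : ℝ) * (n - 2)! * numD (n - 1))|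
          ≤ 2 * (k₁ : ℝ) ^ 2 * (k₂ : ℝ) * (n - 1)! * (n - 3)!) ∧
        -- comparison with the lexicographic family of the same size
        disj (lexInitial n (cosetUnion V).card) ≤ disj (cosetUnion V) ∧
        (disj (cosetUnion V) = disj (lexInitial n (cosetUnion V).card) ↔ IsCanonical V) := by
  -- With c = 1/4, 16 k₁² ≤ n; this gives n ≥ 5, k₁ ≤ n and binomial(k₁, 2) ≤ n-1, which is all that
  -- is needed.
  refine ⟨1 / 4, by norm_num, ?_⟩
  intro n V k₁ k₂ k₃ k₄ h1 h2 h3 h4 hk hkn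
  rw [cliqueCount_eq] at h2 h3 h4
  have hn : 16 * k₁ ^ 2 ≤ n := by
    have h := mul_self_le_mul_self (Nat.cast_nonneg k₁) hkn
    have hs := Real.mul_self_sqrt (Nat.cast_nonneg (α := ℝ) n)
    have : (16 * k₁ ^ 2 : ℝ) ≤ n := by nlinarith
    exact_mod_cast this
  obtain ⟨m, rfl⟩ : ∃ m, n = m + 5 := Nat.exists_eq_add_of_le' (by nlinarith)
  have hkn1 : k₁ ≤ m + 5 := by nlinarith
  have hk3 : k₃ ≤ k₁ * k₂ := by rw [h1, h2, h3]; exact card_cliques_three_le V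
  have hk2 : k₂ ≤ k₁.choose 2 := by rw [h1, h2]; exact card_cliques_two_le V
  have hch : 2 * k₁.choose 2 = k₁ * (k₁ - 1) := by
    rw [Nat.choose_two_right, Nat.mul_div_cancel' (Nat.even_mul_pred_self k₁).two_dvd]
  have hchR : 2 * (k₁.choose 2 : ℝ) = k₁ * (k₁ - 1) := by
    have := congrArg (Nat.cast (R := ℝ)) hch
    rwa [Nat.cast_mul, Nat.cast_mul, Nat.cast_sub (by omega), Nat.cast_one] at this
  have hkR : (2 : ℝ) ≤ k₁ := by exact_mod_cast hk
  have hk3R : (k₃ : ℝ) ≤ k₁ * k₂ := by exact_mod_cast hk3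
  have hk2R : (k₂ : ℝ) ≤ k₁.choose 2 := by exact_mod_cast hk2
  have hsl := card_cosetUnion_add_le V
  have hsu := le_card_cosetUnion_add V
  have hs0 := card_mul_factorial_le V
  have hs1 := card_cosetUnion_le V
  have hE := excess_le (by omega) V
  have hE0 := excess_nonneg V
  have hE1 := excess_eq_zero_iff (by omega) V
  have hEdef : excess V = (disj (cosetUnion V) : ℤ) - (((V.card : ℤ) - 1) * numD (m + 4) *
    (cosetUnion V).card - V.card.choose 2 * (m + 4)! * numD (m + 4)) := rfl
  rw [← h1, ← h2, ← h3] at hsl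
  rw [← h1, ← h2, ← h3, ← h4] at hsu
  rw [← h1, ← h2] at hs0 hE
  rw [← h1] at hs1
  have hD : numD (m + 4) ≤ (m + 4)! := numD_le_factorial (m + 3)
  have hFu : (m + 4)! = (m + 4) * (m + 3)! := Nat.factorial_succ (m + 3)
  have hut : (m + 3)! = (m + 3) * (m + 2)! := Nat.factorial_succ (m + 2)
  have hsq : (m + 3)! ^ 2 ≤ (m + 4)! * (m + 2)! := by
    rw [hFu, sq]
    nth_rw 2 [hut]
    rw [mul_left_comm, mul_assoc]
    exact Nat.mul_le_mul_right _ (by omega)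
  have hkm : k₁.choose 2 ≤ m + 4 := by
    have h5 : k₁ * (k₁ - 1) ≤ k₁ ^ 2 := by
      rw [sq]; exact Nat.mul_le_mul_left _ (Nat.sub_le k₁ 1)
    have h6 : 0 < k₁ ^ 2 := by positivity
    omega
  -- The overlaps total at most k₂ (n-2)! ≤ (n-1)!, so the lexicographic segment of this size ends
  -- inside its k₁-th coset.
  have hs2 : (k₁ - 1) * (m + 4)! ≤ (cosetUnion V).card := by
    have h5 : k₂ * (m + 3)! ≤ (m + 4)! := by
      rw [hFu]; exact Nat.mul_le_mul_right _ (hk2.trans hkm)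
    have h6 : (k₁ - 1) * (m + 4)! + (m + 4)! = k₁ * (m + 4)! := by
      rw [← Nat.succ_mul, Nat.succ_eq_add_one, Nat.sub_add_cancel (by omega)]
    change k₁ * (m + 4)! ≤ _ + k₂ * (m + 3)! at hs0
    omega
  have hlex : (disj (lexInitial (m + 5) (cosetUnion V).card) : ℤ) =
      ((k₁ : ℤ) - 1) * numD (m + 4) * (cosetUnion V).card -
        k₁.choose 2 * (m + 4)! * numD (m + 4) := by
    have hk1 : k₁ - 1 + 1 = k₁ := by omega
    have ha : k₁ - 1 < m + 4 + 1 := by omega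
    have hs3 : (cosetUnion V).card ≤ (k₁ - 1 + 1) * (m + 4)! := by rw [hk1]; exact hs1
    have h := disj_lexInitial ha hs2 hs3
    rw [hk1, Nat.cast_sub (by omega), Nat.cast_one] at h
    exact h
  rw [← h1] at hEdef
  have hcomp : excess V = (disj (cosetUnion V) : ℤ) -
      disj (lexInitial (m + 5) (cosetUnion V).card) := by
    rw [hlex]; exact hEdef
  simp only [show m + 5 - 1 = m + 4 by omega, show m + 5 - 2 = m + 3 by omega,
    show m + 5 - 3 = m + 2 by omega, show m + 5 - 4 = m + 1 by omega] at *
  refine ⟨?_, fun π hπ => ?_, ?_, ?_, ?_⟩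
  · have hsl' := (Nat.cast_le (α := ℝ)).2 hsl
    have hsu' := (Nat.cast_le (α := ℝ)).2 hsu
    push_cast at hsl' hsu'
    have : (0 : ℝ) ≤ (k₄ : ℝ) * (m + 1)! := by positivity
    rw [abs_le]
    constructor <;> linarith
  · obtain ⟨hl, hu⟩ := disjFrom_cosetUnion_bounds (by omega) hπ
    rw [← h1, ← h2] at hl
    rw [← h1, ← h2, ← h3] at hu
    have hl' := (Nat.cast_le (α := ℝ)).2 hl
    have hu' := (Nat.cast_le (α := ℝ)).2 hu
    simp only [show m + 5 - 1 = m + 4 by omega, show m + 5 - 2 = m + 3 by omega,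
      show m + 5 - 3 = m + 2 by omega] at hl' hu'
    push_cast at hl' hu'
    have e1 : (k₂ : ℝ) * (m + 2)! ≤ k₁ * k₂ * (m + 2)! :=
      mul_le_mul_of_nonneg_right (le_mul_of_one_le_left (by positivity) (by linarith))
        (by positivity)
    have e2 : (k₃ : ℝ) * (m + 2)! ≤ k₁ * k₂ * (m + 2)! :=
      mul_le_mul_of_nonneg_right hk3R (by positivity)
    have e3 : (0 : ℝ) ≤ k₁ * k₂ * (m + 2)! := by positivity
    rw [abs_le]
    constructor <;> linarith
  · have hsl' := (Nat.cast_le (α := ℝ)).2 hsl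
    have hs0' := (Nat.cast_le (α := ℝ)).2 hs0
    have hsq' := (Nat.cast_le (α := ℝ)).2 hsq
    have hD' := (Nat.cast_le (α := ℝ)).2 hD
    have hE' := (Int.cast_le (R := ℝ)).2 hE
    have hE0' := (Int.cast_le (R := ℝ)).2 hE0
    have hEd := congrArg (Int.cast (R := ℝ)) hEdef
    push_cast at hsl' hs0' hsq' hE' hE0' hEd
    clear hsl hsu hs0 hs1 hE hE0 hE1 hEdef hcomp hlex hs2 hkm hFu hut hsq hD hkn
    generalize ((cosetUnion V).card : ℝ) = s at *
    generalize (disj (cosetUnion V) : ℝ) = d at *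
    generalize (excess V : ℝ) = E at *
    have hF0 : (0 : ℝ) ≤ (m + 4)! := by positivity
    have hu0 : (0 : ℝ) ≤ (m + 3)! := by positivity
    have ht0 : (0 : ℝ) ≤ (m + 2)! := by positivity
    have hD0 : (0 : ℝ) ≤ numD (m + 4) := by positivity
    have hk20 : (0 : ℝ) ≤ k₂ := by positivity
    have hk30 : (0 : ℝ) ≤ k₃ := by positivity
    generalize ((m + 4)! : ℝ) = F at *
    generalize ((m + 3)! : ℝ) = u at *
    generalize ((m + 2)! : ℝ) = t at *
    generalize (numD (m + 4) : ℝ) = D at *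
    generalize (k₁.choose 2 : ℝ) = C at *
    generalize (k₁ : ℝ) = k at *
    generalize (k₂ : ℝ) = p at *
    generalize (k₃ : ℝ) = q at *
    have hk10 : 0 ≤ k - 1 := by linarith
    -- The error splits into the excess and the size error scaled by (k-1)D, both non-negative;
    -- together they are at most (3/2)k(k-1)pFt + kpFt ≤ 2k²pFt.
    have hkey : d - (C * F * D - (k - 1) * p * u * D) =
        E + (k - 1) * D * (s - (k * F - p * u)) := by
      linear_combination -hEd - F * D * hchR
    have hFt : 0 ≤ F * t := mul_nonneg hF0 ht0
    have hlow : 0 ≤ (k - 1) * D * (s - (k * F - p * u)) :=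
      mul_nonneg (mul_nonneg hk10 hD0) (by linarith)
    have e1 : (k - 1) * D * (s - (k * F - p * u)) ≤ (k - 1) * F * (k * p * t) :=
      mul_le_mul (mul_le_mul_of_nonneg_left hD' hk10)
        (by linarith [mul_le_mul_of_nonneg_right hk3R ht0]) (by linarith)
        (mul_nonneg hk10 hF0)
    have e2 : p ^ 2 * u ^ 2 ≤ p * C * (F * t) :=
      mul_le_mul (by rw [sq]; exact mul_le_mul_of_nonneg_left hk2R hk20) hsq' (sq_nonneg u)
        (mul_nonneg hk20 (hk20.trans hk2R))
    have e3 : p * C * (F * t) = k * (k - 1) * p * (F * t) / 2 := by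
      linear_combination p * (F * t) / 2 * hchR
    have e4 : 0 ≤ k * p * (F * t) := by positivity
    have e5 : 2 * (k * p * (F * t)) ≤ k * (k * p * (F * t)) :=
      mul_le_mul_of_nonneg_right hkR e4
    rw [hkey, abs_of_nonneg (by linarith)]
    linarith
  · zify; linarith
  · rw [← hE1, hcomp, sub_eq_zero, Nat.cast_inj]
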